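/- Let $(n_1,n_2)=(1,1)$, or $n_1=3$ and $n_2\ge 3$. Let $G=K_{n_1,n_2}$ be the complete bipartite graph and let $U$ be its Grover matrix: the $2n_1n_2\times 2n_1n_2$ matrix indexed by the arcs $e=(o(e),t(e))$ of $G$ with $U_{ef}=2/\deg t(f)$ if $t(f)=o(e)$ and $f\ne e^{-1}$, $U_{ef}=2/\deg t(f)-1$ if $f=e^{-1}$, and $U_{ef}=0$ otherwise. Put $\zeta_U(u)=\det(I-uU)^{-1}$. Notation. For a function $f$ on $(1,\infty)$ let $Z_f(w,s)=\frac{1}{\Gamma(w)}\int_1^\infty f(x)\,x^{-s-1}(\log x)^{w-1}\,dx$, continued meromorphically in $w$ from a right half-plane to $\mathbb C$, and let $\zeta_f(s)=\exp\big(\partial_w Z_f(w,s)|_{w=0}\big)$, continued meromorphically in $s$ to $\mathbb C$. For $\omega=(\omega_1,\dots,\omega_r)$ with positive entries and $|\omega|=\omega_1+\dots+\omega_r$, let $\zeta_r(w,x,\omega)=\sum_{k\in\mathbb Z_{\ge0}^r}(k_1\omega_1+\dots+k_r\omega_r+x)^{-w}$ (with principal powers), continued meromorphically in $w$; let $\Gamma_r(x,\omega)=\exp\big(\partial_w\zeta_r(w,x,\omega)|_{w=0}\big)$,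 continued meromorphically in $x$ to $\mathbb C$; and let $S_r(x,\omega)=\Gamma_r(x,\omega)^{-1}\,\Gamma_r(|\omega|-x,\omega)^{(-1)^r}$. Let $b=(n_1-1)(n_2-1)+1$ and $\mathbf n=(2,\dots,2,4,\dots,4)\in\mathbb R^b$, with $(n_1-2)(n_2-2)$ entries equal to $2$ followed by $n_1+n_2-2$ entries equal to $4$. Then: 1. $\displaystyle \zeta_U(u)=-\frac{1}{(u^2-1)^{(n_1-2)(n_2-2)}(u^4-1)^{n_1+n_2-2}}$. In particular $\zeta_U(1/x)=-x^{2n_1n_2}\zeta_U(x)$, that is, $\zeta_U$ is an absolute automorphic form of weight $-2n_1n_2$ with sign $C=-1$. 2. Let $\mathrm{Re}(s)>-2n_1n_2$. For $\mathrm{Re}(w)>b$ the integral defining $Z_{\zeta_U}(w,s)$ and the series defining $\zeta_b(w,s+2n_1n_2,\mathbf n)$ converge absolutely. The function $Z_{\zeta_U}(\cdot,s)$ extends meromorphically to $\mathbb C$ and is holomorphic at $w=0$, and for all $w$ $$Z_{\zeta_U}(w,s)=-\zeta_b(w,s+2n_1n_2,\mathbf n).$$ 3. The function $s\mapsto\exp\big(\partial_wZ_{\zeta_U}(w,s)|_{w=0}\big)$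 on $\mathrm{Re}(s)>-2n_1n_2$ extends meromorphically to $\mathbb C$, and the extension $\zeta_{\zeta_U}$ satisfies $\zeta_{\zeta_U}(s)=\Gamma_b(s+2n_1n_2,\mathbf n)^{-1}$ for all $s\in\mathbb C$ (the right-hand side being $0$ at the poles of $\Gamma_b$). 4. As meromorphic functions of $s$ on $\mathbb C$, and pointwise at every $s$ such that neither $s$ nor $-s-2n_1n_2$ is of the form $\sum_j k_j\mathbf n_j$ with $k\in\mathbb Z_{\ge0}^b$, $$\zeta_{\zeta_U}(-2n_1n_2-s)^{-1}=\varepsilon(s)\,\zeta_{\zeta_U}(s),\qquad \varepsilon(s)=S_b(s+2n_1n_2,\mathbf n)^{-1}.$$ -/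

import Mathlib

/-- The Grover matrix (flip-flop type) of a finite simple graph, indexed by its arcs:
the entry at `(e, f)` is `2 / d_{t(f)} - 1` if `f = e⁻¹`, it is `2 / d_{t(f)}` if
`t(f) = o(e)` and `f ≠ e⁻¹`, and it is `0` otherwise.
For a dart `e`, `e.fst = o(e)`, `e.snd = t(e)` and `e.symm = e⁻¹`. -/
noncomputable def groverMatrix {V : Type*} [Fintype V] [DecidableEq V] (G : SimpleGraph V)
    [DecidableRel G.Adj] : Matrix G.Dart G.Dart ℂ :=
  Matrix.of fun e f =>
    if f = e.symm then 2 / (G.degree f.snd : ℂ) - 1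
    else if f.snd = e.fst then 2 / (G.degree f.snd : ℂ)
    else 0

/-- The zeta function `ζ_A(u) = det(I - u A)⁻¹` of a square matrix
(with the value `0` at the poles). -/
noncomputable def matrixZeta {ι : Type*} [Fintype ι] [DecidableEq ι] (A : Matrix ι ι ℂ)
    (u : ℂ) : ℂ :=
  (Matrix.det (1 - u • A))⁻¹

/-- Adjacency in a complete bipartite graph is decidable. -/
instance completeBipartiteGraphDecidableRelAdj {V W : Type*} :
    DecidableRel (completeBipartiteGraph V W).Adj :=
  fun v w => inferInstanceAs
    (Decidable (v.isLeft = true ∧ w.isRight = true ∨ v.isRight = true ∧ w.isLeft = true))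

/-- The zeta function `ζ_{U_G}` of the Grover walk on `G`. -/
noncomputable def groverZeta {V : Type*} [Fintype V] [DecidableEq V] (G : SimpleGraph V)
    [DecidableRel G.Adj] (u : ℂ) : ℂ :=
  matrixZeta (groverMatrix G) u

/-- `f` is an absolute automorphic form of weight `D` with sign `C`:
`f(1/x) = C x^{-D} f(x)` (functions with poles are given the value `0` there). -/
def IsAbsoluteAutomorphicForm (f : ℝ → ℂ) (C D : ℤ) : Prop :=
  (C = 1 ∨ C = -1) ∧ ∀ x : ℝ, x ≠ 0 → f (1 / x) = (C : ℂ) * (x : ℂ) ^ (-D) * f x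

/-- `g` is the meromorphic continuation to `ℂ` of the function given by `F` on some right
half-plane. Normal form means that `g` has no removable singularities and that it takes the
value `0` at its poles, so that `g` is determined at every point. -/
def IsMeromorphicContinuation (F g : ℂ → ℂ) : Prop :=
  MeromorphicNFOn g Set.univ ∧ ∃ c : ℝ, ∀ z : ℂ, c < z.re → g z = F z

/-- Two meromorphic continuations of the same function are equal. -/
theorem IsMeromorphicContinuation.unique {F g h : ℂ → ℂ} (hg : IsMeromorphicContinuation F g)
    (hh : IsMeromorphicContinuation F h) : g = h := by
  obtain ⟨hgN, c, hc⟩ := hg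
  obtain ⟨hhN, d, hd⟩ := hh
  have hm : MeromorphicOn (g - h) Set.univ := hgN.meromorphicOn.sub hhN.meromorphicOn
  have hopen : IsOpen {z : ℂ | max c d < z.re} := isOpen_lt continuous_const Complex.continuous_re
  have htop : meromorphicOrderAt (g - h) ((max c d + 1 : ℝ) : ℂ) = ⊤ := by
    rw [meromorphicOrderAt_eq_top_iff]
    refine Filter.Eventually.filter_mono nhdsWithin_le_nhds ?_
    have hmem : ((max c d + 1 : ℝ) : ℂ) ∈ {z : ℂ | max c d < z.re} := by
      simp only [Set.mem_setOf_eq, Complex.ofReal_re]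
      exact lt_add_one _
    filter_upwards [hopen.mem_nhds hmem] with z hz
    have hz' : max c d < z.re := hz
    simp [hc z (lt_of_le_of_lt (le_max_left c d) hz'), hd z (lt_of_le_of_lt (le_max_right c d) hz')]
  funext z
  have hz : meromorphicOrderAt (g - h) z = ⊤ := by
    by_contra hne
    exact hm.meromorphicOrderAt_ne_top_of_isPreconnected isPreconnected_univ (Set.mem_univ z)
      (Set.mem_univ _) hne htop
  rw [meromorphicOrderAt_eq_top_iff] at hz
  have hz2 : ∀ᶠ y in nhdsWithin z {z}ᶜ, g y = h y := by
    filter_upwards [hz] with y hy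
    exact sub_eq_zero.mp hy
  exact (((hgN (Set.mem_univ z)).eventuallyEq_nhdsNE_iff_eventuallyEq_nhds
    (hhN (Set.mem_univ z))).mp hz2).self_of_nhds

open Classical in
/-- The meromorphic continuation to `ℂ` of the function given by `F` on some right half-plane
(and `0` if there is none). -/
noncomputable def meromorphicContinuation (F : ℂ → ℂ) : ℂ → ℂ :=
  if h : ∃ g, IsMeromorphicContinuation F g then h.choose else 0

/-- The integrand `f(x) x^{-s-1} (log x)^{w-1}` of the absolute Hurwitz zeta function. -/
noncomputable def absoluteHurwitzIntegrand (f : ℝ → ℂ) (w s : ℂ) (x : ℝ) : ℂ :=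
  f x * (x : ℂ) ^ (-s - 1) * (Real.log x : ℂ) ^ (w - 1)

/-- The integral `Γ(w)⁻¹ ∫_1^∞ f(x) x^{-s-1} (log x)^{w-1} dx`. -/
noncomputable def absoluteHurwitzIntegral (f : ℝ → ℂ) (w s : ℂ) : ℂ :=
  (Complex.Gamma w)⁻¹ * ∫ x in Set.Ioi (1 : ℝ), absoluteHurwitzIntegrand f w s x

/-- The absolute Hurwitz zeta function `Z_f(w, s)`: the integral, continued in `w`. -/
noncomputable def absoluteHurwitzZeta (f : ℝ → ℂ) (w s : ℂ) : ℂ :=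
  meromorphicContinuation (fun w' => absoluteHurwitzIntegral f w' s) w

/-- The absolute zeta function `ζ_f(s) = exp (∂_w Z_f(w, s) |_{w = 0})`, continued in `s`. -/
noncomputable def absoluteZeta (f : ℝ → ℂ) : ℂ → ℂ :=
  meromorphicContinuation fun s =>
    Complex.exp (deriv (fun w => absoluteHurwitzZeta f w s) 0)

/-- The term `(k_1 ω_1 + ⋯ + k_r ω_r + x)^{-s}` of the multiple Hurwitz zeta series. -/
noncomputable def multipleHurwitzTerm {r : ℕ} (s x : ℂ) (ω : Fin r → ℝ) (k : Fin r → ℕ) : ℂ :=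
  ((∑ j, (k j : ℂ) * (ω j : ℂ)) + x) ^ (-s)

/-- The multiple Hurwitz zeta function `ζ_r(s, x, ω)` of order `r`: the series
`∑_{k ∈ ℕ^r} (k_1 ω_1 + ⋯ + k_r ω_r + x)^{-s}`, continued in `s`. -/
noncomputable def multipleHurwitzZeta {r : ℕ} (s x : ℂ) (ω : Fin r → ℝ) : ℂ :=
  meromorphicContinuation (fun s' => ∑' k : Fin r → ℕ, multipleHurwitzTerm s' x ω k) s

/-- The multiple gamma function `Γ_r(x, ω) = exp (∂_s ζ_r(s, x, ω) |_{s = 0})`,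
continued in `x`. -/
noncomputable def multipleGamma {r : ℕ} (x : ℂ) (ω : Fin r → ℝ) : ℂ :=
  meromorphicContinuation
    (fun x' => Complex.exp (deriv (fun s => multipleHurwitzZeta s x' ω) 0)) x

/-- The multiple sine function
`S_r(x, ω) = Γ_r(x, ω)^{-1} Γ_r(ω_1 + ⋯ + ω_r - x, ω)^{(-1)^r}`. -/
noncomputable def multipleSine {r : ℕ} (x : ℂ) (ω : Fin r → ℝ) : ℂ :=
  (multipleGamma x ω)⁻¹ * multipleGamma ((∑ j, (ω j : ℂ)) - x) ω ^ ((-1 : ℤ) ^ r)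

/-- The vector `(2, …, 2, 4, …, 4)` with `(n₁ - 1)(n₂ - 1) + 1` entries, of which the first
`(n₁ - 2)(n₂ - 2)` are equal to `2`. -/
noncomputable def bipartitePeriods (n₁ n₂ : ℕ) : Fin ((n₁ - 1) * (n₂ - 1) + 1) → ℝ :=
  fun j => if ((j : ℕ) : ℤ) < ((n₁ : ℤ) - 2) * ((n₂ : ℤ) - 2) then 2 else 4

/-! The walk alternates between the two sides of the graph, so `U` is block off-diagonal and `det(I
- uU)` reduces to `det(1 - u² C₁ ⊗ C₂)`, where `C_i = (2/n_i) J - 1`. Each `C_i` has the eigenvalue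
`1` once and `-1` otherwise. Hence the determinant is `(1 - u²)^b (1 + u²)^q` with `q = n₁ + n₂ -
2`. Since `b = p + q` is odd, where `p = (n₁ - 2)(n₂ - 2)`, this is `-(u² - 1)^p (u⁴ - 1)^q`.
Automorphy is then a sign count.

Substituting `x = e^t` turns the integral for `Z_f` into minus the Mellin transform of `e^{-(s+N)t}
(1 - e^{-2t})^{-p} (1 - e^{-4t})^{-q}`, `N = 2p + 4q`. Expanding in geometric series and integrating
termwise gives minus the multiple Hurwitz series with periods `2` (`p` times) and `4` (`q` times).
By uniqueness of continuation, `Z_f = -ζ_b` everywhere.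

The analytic work is to continue `ζ_b` to `w = 0` and to show that `1/Γ_b` is entire. From `(1 -
e^{-2t})^{-1} = (1 + e^{-2t})(1 - e^{-4t})^{-1}`, `ζ_b` is a finite binomial combination of
one-dimensional series `∑ binom(m+d, d) (4m + y)^{-w}`, `d + 1 = b`. With finitely many terms
removed, such a series expands in powers of `y`; the coefficients are binomials in `w` times
combinations of shifted Riemann zetas, and the zero of the binomial at `w = 0` cancels the simple
pole (`exists_shiftCoeff`). Thus the tail is regular at `0` with derivative holomorphic in `y` on a
disc, while the removed terms contribute a polynomial in `y` to `exp(-∂_w)`. The discs exhaust the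
plane, and the local functions glue to an entire function (`exists_entire_baseSeries`). A finite
product of its translates is `G = 1/Γ_b` (`exists_entire_multipleGamma_inv`).

Consequently `ζ_f(s) = G(s + N)`. As `b` is odd, `S_b(s + N) = G(s + N) G(-s)`, which is the
functional equation. -/

/-! ### The determinant of the Grover walk on a complete bipartite graph. -/

section GroverDeterminant

open Matrix
open scoped Kronecker

/-- The Grover coin `(2 / m) J - 1` of size `m`. -/
noncomputable def groverCoin (m : ℕ) : Matrix (Fin m) (Fin m) ℂ :=
  Matrix.of fun i j => 2 / (m : ℂ) - if i = j then 1 else 0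

theorem groverCoin_eq_rank_one_sub (m : ℕ) : groverCoin m =
    (2 / (m : ℂ)) • (Matrix.replicateCol Unit (fun _ : Fin m => (1 : ℂ)) *
      Matrix.replicateRow Unit fun _ : Fin m => (1 : ℂ)) - 1 := by
  ext i j
  simp [groverCoin, Matrix.mul_apply, Matrix.one_apply]

/-- Up to the scalar `1 - v` the matrix is a rank-one perturbation of the identity, so the matrix
determinant lemma applies. -/
theorem det_one_add_smul_groverCoin {m : ℕ} (hm : m ≠ 0) {v : ℂ} (hv : v ≠ 1) :
    (1 + v • groverCoin m).det = (1 - v) ^ (m - 1) * (1 + v) := by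
  have hm' : (m : ℂ) ≠ 0 := Nat.cast_ne_zero.mpr hm
  have hv' : 1 - v ≠ 0 := sub_ne_zero.mpr (Ne.symm hv)
  have h : 1 + v • groverCoin m = (1 - v) •
      (1 + Matrix.replicateCol Unit (fun _ : Fin m => 2 * v / (m * (1 - v))) *
        Matrix.replicateRow Unit fun _ : Fin m => (1 : ℂ)) := by
    ext i j
    simp [groverCoin, Matrix.mul_apply, Matrix.one_apply]
    field_simp
    split_ifs <;> ring
  rw [h, Matrix.det_smul, Matrix.det_one_add_replicateCol_mul_replicateRow]
  obtain ⟨k, rfl⟩ := Nat.exists_eq_succ_of_ne_zero hm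
  simp [dotProduct] at hm' ⊢
  field_simp
  ring

/-- The exponents are the multiplicities of the eigenvalues `1` and `-1` of the tensor product.
Instead of diagonalising, the proof writes the second coin as a rank-one matrix minus `1` and
applies `det(1 - AB) = det(1 - BA)`, which leaves determinants of size `m`. -/
theorem det_one_sub_smul_groverCoin_kronecker {m n : ℕ} (hm : m ≠ 0) (hn : n ≠ 0) (v : ℂ) :
    (1 - v • (groverCoin m ⊗ₖ groverCoin n)).det =
      (1 - v) ^ ((m - 1) * (n - 1) + 1) * (1 + v) ^ (m - 1 + (n - 1)) := by
  suffices h : ∀ v : ℂ, v ∈ ({1, -1}ᶜ : Set ℂ) →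
      (1 - v • (groverCoin m ⊗ₖ groverCoin n)).det =
      (1 - v) ^ ((m - 1) * (n - 1) + 1) * (1 + v) ^ (m - 1 + (n - 1)) by
    -- Both sides are continuous in `v`, so `v = ±1`, where `1 + v X` may be singular, can be left
    -- out.
    have hd : Dense ({1, -1}ᶜ : Set ℂ) :=
      (Set.toFinite ({1, -1} : Set ℂ)).countable.dense_compl ℝ
    refine congrFun (Continuous.ext_on hd ?_ ?_ h) v
    · exact Continuous.matrix_det (by fun_prop)
    · fun_prop
  intro v hv
  simp only [Set.mem_compl_iff, Set.mem_insert_iff, Set.mem_singleton_iff, not_or] at hv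
  obtain ⟨h1, h2⟩ := hv
  have hn' : (n : ℂ) ≠ 0 := Nat.cast_ne_zero.mpr hn
  have hv1 : 1 - v ≠ 0 := sub_ne_zero.mpr (Ne.symm h1)
  have hv2 : 1 + v ≠ 0 := fun h => h2 (by linear_combination h)
  set X := groverCoin m with hX
  have hdet : (1 + v • X).det = (1 - v) ^ (m - 1) * (1 + v) := det_one_add_smul_groverCoin hm h1
  have hdet' : (1 - v • X).det = (1 + v) ^ (m - 1) * (1 - v) := by
    have := det_one_add_smul_groverCoin hm (v := -v) (fun h => h2 (by linear_combination -h))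
    rw [← hX, neg_smul, ← sub_eq_add_neg] at this
    rw [this]; ring
  have hunit : IsUnit (1 + v • X).det := by
    rw [hdet]; exact (mul_ne_zero (pow_ne_zero _ hv1) hv2).isUnit
  set C := 1 + v • X with hC
  set U := Matrix.replicateCol Unit (fun _ : Fin n => (1 : ℂ)) with hU
  set R := Matrix.replicateRow Unit (fun _ : Fin n => (1 : ℂ)) with hR
  have hRU : R * U = (n : ℂ) • (1 : Matrix Unit Unit ℂ) := by
    ext i j
    simp [hR, hU, Matrix.mul_apply]
  have key : 1 - v • (X ⊗ₖ groverCoin n) =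
      (C ⊗ₖ (1 : Matrix (Fin n) (Fin n) ℂ)) *
        (1 - (((2 * v / n) • (C⁻¹ * X)) ⊗ₖ U) * ((1 : Matrix (Fin m) (Fin m) ℂ) ⊗ₖ R)) := by
    rw [Matrix.mul_sub, Matrix.mul_one, ← Matrix.mul_kronecker_mul, ← Matrix.mul_kronecker_mul,
      Matrix.mul_one, Matrix.one_mul, Matrix.mul_smul, ← Matrix.mul_assoc,
      Matrix.mul_nonsing_inv _ hunit, Matrix.one_mul, groverCoin_eq_rank_one_sub, ← hU, ← hR, hC]
    ext ⟨i, k⟩ ⟨j, l⟩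
    simp [Matrix.kroneckerMap_apply, Matrix.one_apply]
    ring_nf
    split_ifs <;> simp_all
    ring
  rw [key, Matrix.det_mul, Matrix.det_kronecker, Matrix.det_one_sub_mul_comm,
    ← Matrix.mul_kronecker_mul, hRU, Matrix.one_mul]
  have h3 : (1 : Matrix (Fin m × Unit) (Fin m × Unit) ℂ) -
      ((2 * v / n) • (C⁻¹ * X)) ⊗ₖ ((n : ℂ) • (1 : Matrix Unit Unit ℂ)) =
      (C⁻¹ * (1 - v • X)) ⊗ₖ (1 : Matrix Unit Unit ℂ) := by
    have h4 : 1 - v • X = C - (2 * v) • X := by rw [hC]; module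
    rw [h4, Matrix.mul_sub, Matrix.nonsing_inv_mul _ hunit]
    ext ⟨i, k⟩ ⟨j, l⟩
    simp [Matrix.kroneckerMap_apply, Matrix.one_apply]
    field_simp
  rw [h3, Matrix.det_kronecker, Matrix.det_mul, Matrix.det_nonsing_inv, hdet, hdet',
    Ring.inverse_eq_inv']
  obtain ⟨m, rfl⟩ := Nat.exists_eq_succ_of_ne_zero hm
  obtain ⟨n, rfl⟩ := Nat.exists_eq_succ_of_ne_zero hn
  have hpow : ((1 - v) ^ m * (1 + v)) ^ n = (1 - v) ^ (m * n) * (1 + v) ^ n := by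
    rw [mul_pow, ← pow_mul]
  simp only [Nat.succ_sub_one, Fintype.card_unit, pow_one, Matrix.det_one, one_pow, mul_one,
    Fintype.card_fin, pow_succ ((1 - v) ^ m * (1 + v)), hpow]
  field_simp
  ring

/-- The arcs of a complete bipartite graph. -/
def completeBipartiteDart (m n : ℕ) :
    (Fin m × Fin n) ⊕ (Fin m × Fin n) ≃ (completeBipartiteGraph (Fin m) (Fin n)).Dart where
  toFun
    | .inl p => ⟨(.inl p.1, .inr p.2), by simp⟩
    | .inr p => ⟨(.inr p.2, .inl p.1), by simp⟩
  invFun d :=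
    match d with
    | ⟨(.inl i, .inr j), _⟩ => .inl (i, j)
    | ⟨(.inr j, .inl i), _⟩ => .inr (i, j)
    | ⟨(.inl _, .inl _), h⟩ => absurd h (by simp)
    | ⟨(.inr _, .inr _), h⟩ => absurd h (by simp)
  left_inv := by rintro (⟨i, j⟩ | ⟨i, j⟩) <;> rfl
  right_inv := by
    rintro ⟨⟨(i | i), (j | j)⟩, h⟩
    · exact absurd h (by simp)
    · rfl
    · rfl
    · exact absurd h (by simp)

theorem degree_completeBipartiteGraph_inl {m n : ℕ} (i : Fin m) :
    (completeBipartiteGraph (Fin m) (Fin n)).degree (.inl i) = n := by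
  rw [← SimpleGraph.card_neighborFinset_eq_degree]
  have : (completeBipartiteGraph (Fin m) (Fin n)).neighborFinset (.inl i) =
      Finset.univ.map Function.Embedding.inr := by
    ext (x | x) <;> simp
  simp [this]

theorem degree_completeBipartiteGraph_inr {m n : ℕ} (j : Fin n) :
    (completeBipartiteGraph (Fin m) (Fin n)).degree (.inr j) = m := by
  rw [← SimpleGraph.card_neighborFinset_eq_degree]
  have : (completeBipartiteGraph (Fin m) (Fin n)).neighborFinset (.inr j) =
      Finset.univ.map Function.Embedding.inl := by
    ext (x | x) <;> simp
  simp [this]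

/-- An arc leaving the left side can only follow an arc ending at the same left vertex, where the
coin of size `n` acts; the other block is symmetric. -/
theorem groverMatrix_completeBipartiteGraph (m n : ℕ) :
    (groverMatrix (completeBipartiteGraph (Fin m) (Fin n))).submatrix
      (completeBipartiteDart m n) (completeBipartiteDart m n) =
    Matrix.fromBlocks 0 (1 ⊗ₖ groverCoin n) (groverCoin m ⊗ₖ 1) 0 := by
  ext (⟨i, j⟩ | ⟨i, j⟩) (⟨k, l⟩ | ⟨k, l⟩)
  · simp [groverMatrix, completeBipartiteDart, SimpleGraph.Dart.ext_iff,
      SimpleGraph.Dart.symm]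
  · simp [groverMatrix, completeBipartiteDart, SimpleGraph.Dart.ext_iff,
      SimpleGraph.Dart.symm, degree_completeBipartiteGraph_inl, groverCoin, Matrix.one_apply]
    grind
  · simp [groverMatrix, completeBipartiteDart, SimpleGraph.Dart.ext_iff,
      SimpleGraph.Dart.symm, degree_completeBipartiteGraph_inr, groverCoin, Matrix.one_apply]
    grind
  · simp [groverMatrix, completeBipartiteDart, SimpleGraph.Dart.ext_iff,
      SimpleGraph.Dart.symm]

theorem groverZeta_completeBipartiteGraph {m n : ℕ} (hm : m ≠ 0) (hn : n ≠ 0) (u : ℂ) :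
    groverZeta (completeBipartiteGraph (Fin m) (Fin n)) u =
      ((1 - u ^ 2) ^ ((m - 1) * (n - 1) + 1) * (1 + u ^ 2) ^ (m - 1 + (n - 1)))⁻¹ := by
  rw [groverZeta, matrixZeta, ← Matrix.det_submatrix_equiv_self (completeBipartiteDart m n)]
  have h : (1 - u • groverMatrix (completeBipartiteGraph (Fin m) (Fin n))).submatrix
      (completeBipartiteDart m n) (completeBipartiteDart m n) =
      Matrix.fromBlocks 1 (-(u • (1 ⊗ₖ groverCoin n))) (-(u • (groverCoin m ⊗ₖ 1))) 1 := by
    have h1 : (1 - u • groverMatrix (completeBipartiteGraph (Fin m) (Fin n))).submatrix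
        (completeBipartiteDart m n) (completeBipartiteDart m n) =
        1 - u • (groverMatrix (completeBipartiteGraph (Fin m) (Fin n))).submatrix
        (completeBipartiteDart m n) (completeBipartiteDart m n) := by
      simp [Matrix.submatrix_sub, Matrix.submatrix_smul, Matrix.submatrix_one_equiv]
    rw [h1, groverMatrix_completeBipartiteGraph, ← Matrix.fromBlocks_one, Matrix.fromBlocks_smul,
      sub_eq_add_neg, Matrix.fromBlocks_neg, Matrix.fromBlocks_add]
    simp
  rw [h, Matrix.det_fromBlocks_one₁₁, Matrix.neg_mul, Matrix.mul_neg, neg_neg, Matrix.smul_mul, Matrix.mul_smul,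
    smul_smul, ← Matrix.mul_kronecker_mul, Matrix.mul_one, Matrix.one_mul, ← sq,
    det_one_sub_smul_groverCoin_kronecker hm hn]

end GroverDeterminant

/-! ### Expansion of shifted Dirichlet series in powers of the shift. -/

section ShiftedDirichletSeries

open Filter Topology

/-- The binomial coefficient `binom(-s, j)`. -/
noncomputable def negBinom (s : ℂ) (j : ℕ) : ℂ := ∏ i ∈ Finset.range j, (-s - i) / (i + 1)

theorem negBinom_succ (s : ℂ) (j : ℕ) :
    negBinom s (j + 1) = negBinom s j * ((-s - j) / (j + 1)) := Finset.prod_range_succ _ _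

theorem ringChoose_neg_eq_negBinom (s : ℂ) (j : ℕ) : Ring.choose (-s) j = negBinom s j := by
  rw [Ring.choose_eq_smul, smul_eq_mul]
  induction j with
  | zero => simp [negBinom]
  | succ j ih =>
    have hj : ((j : ℂ) + 1) ≠ 0 := Nat.cast_add_one_ne_zero j
    have hf : ((j.factorial : ℕ) : ℂ) ≠ 0 := Nat.cast_ne_zero.mpr j.factorial_ne_zero
    rw [negBinom_succ, ← ih, descPochhammer_succ_right, Polynomial.smeval_mul]
    simp only [Polynomial.smeval_sub, Polynomial.smeval_X, Polynomial.smeval_natCast,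
      Nat.factorial_succ, Nat.cast_mul, Nat.cast_succ, pow_one, pow_zero, nsmul_eq_mul, mul_one]
    field_simp

theorem hasSum_negBinom (s : ℂ) {z : ℂ} (hz : ‖z‖ < 1) :
    HasSum (fun j => negBinom s j * z ^ j) ((1 + z) ^ (-s)) := by
  have h := (Complex.one_add_cpow_hasFPowerSeriesOnBall_zero (a := -s)).hasSum (y := z)
    (by simpa [← ofReal_norm] using hz)
  simpa only [zero_add, binomialSeries_apply, ringChoose_neg_eq_negBinom, List.ofFn_const,
    List.prod_replicate, smul_eq_mul] using h

theorem differentiable_negBinom (j : ℕ) : Differentiable ℂ fun s => negBinom s j := by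
  unfold negBinom
  fun_prop

/-- The majorant `|binom(-K, j)|` of `binom(-s, j)` for `‖s‖ ≤ K`. -/
noncomputable def absBinom (K : ℝ) (j : ℕ) : ℝ := ∏ i ∈ Finset.range j, (K + i) / (i + 1)

theorem absBinom_nonneg {K : ℝ} (hK : 0 ≤ K) (j : ℕ) : 0 ≤ absBinom K j :=
  Finset.prod_nonneg fun i _ => by positivity

theorem norm_negBinom_le {s : ℂ} {K : ℝ} (hs : ‖s‖ ≤ K) (j : ℕ) :
    ‖negBinom s j‖ ≤ absBinom K j := by
  rw [negBinom, norm_prod, absBinom]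
  refine Finset.prod_le_prod (fun _ _ => norm_nonneg _) fun i _ => ?_
  rw [norm_div]
  have h1 : ‖((i : ℂ) + 1)‖ = (i : ℝ) + 1 := by
    exact_mod_cast Complex.norm_natCast (i + 1)
  rw [h1]
  gcongr
  calc ‖-s - i‖ ≤ ‖-s‖ + ‖(i : ℂ)‖ := norm_sub_le _ _
    _ ≤ K + i := by rw [norm_neg, Complex.norm_natCast]; gcongr

theorem summable_absBinom {K ρ : ℝ} (hK : 0 ≤ K) (hρ : 0 ≤ ρ) (hρ1 : ρ < 1) :
    Summable fun j => absBinom K j * ρ ^ j := by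
  have h := (hasSum_negBinom (K : ℂ) (z := (ρ : ℂ))
    (by rwa [Complex.norm_real, Real.norm_of_nonneg hρ])).summable.norm
  refine h.congr fun j => ?_
  rw [norm_mul, norm_pow, Complex.norm_real, Real.norm_of_nonneg hρ, negBinom, absBinom, norm_prod]
  congr 1
  refine Finset.prod_congr rfl fun i _ => ?_
  have h1 : (-(K : ℂ) - i) / (i + 1) = ((-((K + i) / (i + 1)) : ℝ) : ℂ) := by
    push_cast; ring
  rw [h1, Complex.norm_real, norm_neg, Real.norm_of_nonneg (by positivity)]

/-- The Dirichlet series `∑ a_m l_m ^ (-s)`. -/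
noncomputable def dirichletSum (a l : ℕ → ℝ) (s : ℂ) : ℂ := ∑' m, (a m : ℂ) * (l m : ℂ) ^ (-s)

theorem norm_dirichletTerm {a l : ℕ → ℝ} {R : ℝ} (ha : ∀ m, 0 ≤ a m) (hR : 1 ≤ R)
    (hl : ∀ m, R ≤ l m) (s : ℂ) (m : ℕ) :
    ‖(a m : ℂ) * (l m : ℂ) ^ (-s)‖ = a m * l m ^ (-s.re) := by
  rw [norm_mul, Complex.norm_real, Real.norm_of_nonneg (ha m),
    Complex.norm_cpow_eq_rpow_re_of_pos (by linarith [hl m]), Complex.neg_re]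

/-- The factor `R ^ (σ - s.re)` is kept because replacing `s` by `s + j` then gains `R ^ (-j)`,
which makes the expansion converge for `‖y‖ < R`. -/
theorem norm_dirichletTerm_le {a l : ℕ → ℝ} {R σ : ℝ} (ha : ∀ m, 0 ≤ a m) (hR : 1 ≤ R)
    (hl : ∀ m, R ≤ l m) {s : ℂ} (hs : σ ≤ s.re) (m : ℕ) :
    ‖(a m : ℂ) * (l m : ℂ) ^ (-s)‖ ≤ R ^ (σ - s.re) * (a m * l m ^ (-σ)) := by
  have hlm : 0 < l m := by linarith [hl m]
  rw [norm_dirichletTerm ha hR hl, mul_left_comm]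
  refine mul_le_mul_of_nonneg_left ?_ (ha m)
  rw [show -s.re = (σ - s.re) + -σ by ring, Real.rpow_add hlm]
  refine mul_le_mul_of_nonneg_right ?_ (by positivity)
  exact Real.rpow_le_rpow_of_nonpos (by linarith) (hl m) (by linarith)

theorem norm_dirichletSum_le {a l : ℕ → ℝ} {R σ : ℝ} (ha : ∀ m, 0 ≤ a m) (hR : 1 ≤ R)
    (hl : ∀ m, R ≤ l m) (hσ : Summable fun m => a m * l m ^ (-σ)) {s : ℂ} (hs : σ ≤ s.re) :
    ‖dirichletSum a l s‖ ≤ R ^ (σ - s.re) * ∑' m, a m * l m ^ (-σ) :=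
  tsum_of_norm_bounded (hσ.hasSum.mul_left _) (norm_dirichletTerm_le ha hR hl hs)

theorem differentiableOn_dirichletSum {a l : ℕ → ℝ} {R σ : ℝ} (ha : ∀ m, 0 ≤ a m) (hR : 1 ≤ R)
    (hl : ∀ m, R ≤ l m) (hσ : Summable fun m => a m * l m ^ (-σ)) :
    DifferentiableOn ℂ (dirichletSum a l) {s | σ < s.re} := by
  refine Complex.differentiableOn_tsum_of_summable_norm hσ (fun m => ?_)
    (isOpen_lt continuous_const Complex.continuous_re) fun m s hs => ?_
  · have : (l m : ℂ) ≠ 0 := by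
      exact_mod_cast (show l m ≠ 0 by linarith [hl m])
    fun_prop (disch := simp [this])
  · refine (norm_dirichletTerm_le ha hR hl (le_of_lt hs) m).trans ?_
    refine mul_le_of_le_one_left ?_ ?_
    · exact mul_nonneg (ha m) (Real.rpow_nonneg (by linarith [hl m]) _)
    · exact Real.rpow_le_one_of_one_le_of_nonpos hR (by linarith [show σ < s.re from hs])

/-- No branch correction occurs because the factor `l` taken out is a positive real. -/
theorem ofReal_add_cpow_eq {l : ℝ} {y : ℂ} (hl : 0 < l) (hy : ‖y‖ < l) (s : ℂ) :
    ((l : ℂ) + y) ^ (-s) = (l : ℂ) ^ (-s) * (1 + y / l) ^ (-s) := by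
  have hl0 : (l : ℂ) ≠ 0 := by exact_mod_cast hl.ne'
  have h1 : 1 + y / l ≠ 0 := by
    intro h
    have : ‖y / (l : ℂ)‖ = 1 := by
      rw [show y / (l : ℂ) = -1 by linear_combination h]; simp
    rw [norm_div, Complex.norm_real, Real.norm_of_nonneg hl.le, div_eq_one_iff_eq hl.ne'] at this
    linarith
  have h2 : (l : ℂ) + y = l * (1 + y / l) := by field_simp
  rw [h2, Complex.cpow_def_of_ne_zero (mul_ne_zero hl0 h1), Complex.cpow_def_of_ne_zero hl0,
    Complex.cpow_def_of_ne_zero h1, Complex.log_ofReal_mul hl h1, ← Complex.exp_add,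
    Complex.ofReal_log hl.le]
  ring_nf

/-- The expansion of a shifted Dirichlet series in powers of the shift. -/
theorem hasSum_shifted_dirichletTerm {a l : ℕ → ℝ} {R σ : ℝ} (ha : ∀ m, 0 ≤ a m) (hR : 1 ≤ R)
    (hl : ∀ m, R ≤ l m) (hσ : Summable fun m => a m * l m ^ (-σ)) {s y : ℂ} (hs : σ ≤ s.re)
    (hy : ‖y‖ < R) :
    HasSum (fun m => (a m : ℂ) * ((l m : ℂ) + y) ^ (-s))
      (∑' j : ℕ, y ^ j * (negBinom s j * dirichletSum a l (s + j))) := by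
  have hR0 : 0 < R := by linarith
  have hl0 (m) : 0 < l m := by linarith [hl m]
  have hlc (m) : (l m : ℂ) ≠ 0 := by exact_mod_cast (hl0 m).ne'
  -- Each shifted power is expanded binomially; the resulting double series is absolutely summable,
  -- so the sums over `m` and `j` may be exchanged.
  set f : ℕ × ℕ → ℂ := fun p =>
    ((a p.1 : ℂ) * (l p.1 : ℂ) ^ (-s)) * (negBinom s p.2 * (y / l p.1) ^ p.2) with hf
  have hsum : Summable f := by
    have h1 : Summable fun m => R ^ (σ - s.re) * (a m * l m ^ (-σ)) := hσ.mul_left _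
    have h2 := summable_absBinom (K := ‖s‖) (ρ := ‖y‖ / R) (norm_nonneg _) (by positivity)
      ((div_lt_one hR0).mpr hy)
    refine Summable.of_norm_bounded (h1.mul_of_nonneg h2 (fun m => ?_) fun j => ?_) fun p => ?_
    · exact mul_nonneg (by positivity) (mul_nonneg (ha m) (Real.rpow_nonneg (hl0 m).le _))
    · exact mul_nonneg (absBinom_nonneg (norm_nonneg _) _) (by positivity)
    · rw [hf, norm_mul, norm_mul (negBinom _ _), norm_pow, norm_div, Complex.norm_real,
        Real.norm_of_nonneg (hl0 _).le]
      have hlp := hl0 p.1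
      refine mul_le_mul (norm_dirichletTerm_le ha hR hl hs _) ?_ ?_ ?_
      · refine mul_le_mul (norm_negBinom_le le_rfl _) ?_ ?_ (absBinom_nonneg (norm_nonneg _) _)
        · have := hl p.1
          gcongr
        · positivity
      · positivity
      · exact mul_nonneg (by positivity) (mul_nonneg (ha _) (Real.rpow_nonneg (hl0 _).le _))
  have hfib (m : ℕ) : HasSum (fun j => f (m, j)) ((a m : ℂ) * ((l m : ℂ) + y) ^ (-s)) := by
    rw [ofReal_add_cpow_eq (hl0 m) (hy.trans_le (hl m)), ← mul_assoc]
    have hz : ‖y / (l m : ℂ)‖ < 1 := by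
      rw [norm_div, Complex.norm_real, Real.norm_of_nonneg (hl0 _).le, div_lt_one (hl0 m)]
      exact hy.trans_le (hl m)
    simp only [hf]
    exact (hasSum_negBinom s hz).mul_left ((a m : ℂ) * (l m : ℂ) ^ (-s))
  have htot := hsum.hasSum.prod_fiberwise hfib
  have hswap : ∑' p, f p = ∑' j, ∑' m, f (m, j) := by
    rw [← (Equiv.prodComm ℕ ℕ).tsum_eq f]
    exact ((Equiv.prodComm ℕ ℕ).summable_iff.mpr hsum).tsum_prod
  rw [hswap] at htot
  refine (congrArg (HasSum _) ?_).mp htot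
  refine tsum_congr fun j => ?_
  rw [dirichletSum, ← tsum_mul_left, ← tsum_mul_left]
  refine tsum_congr fun m => ?_
  simp only [hf]
  rw [neg_add, Complex.cpow_add _ _ (hlc m), Complex.cpow_neg (l m : ℂ) j,
    Complex.cpow_natCast, div_pow]
  field_simp

section Continuation

variable {a l : ℕ → ℝ} {R b : ℝ} {T : ℕ → ℂ → ℂ}

theorem norm_shiftCoeff_le (ha : ∀ m, 0 ≤ a m) (hR : 1 ≤ R) (hl : ∀ m, R ≤ l m) {σ : ℝ}
    (hσ : Summable fun m => a m * l m ^ (-σ)) {K : ℝ} {s y : ℂ} (hs : ‖s‖ ≤ K) {j : ℕ}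
    (hj : σ ≤ s.re + j) (hT : T j s = negBinom s j * dirichletSum a l (s + j)) :
    ‖y ^ j * T j s‖ ≤
      (R ^ (σ + K) * ∑' m, a m * l m ^ (-σ)) * (absBinom K j * (‖y‖ / R) ^ j) := by
  have hR0 : 0 < R := by linarith
  have hS : 0 ≤ ∑' m, a m * l m ^ (-σ) := tsum_nonneg fun m =>
    mul_nonneg (ha m) (Real.rpow_nonneg (by linarith [hl m]) _)
  have hD := norm_dirichletSum_le ha hR hl hσ (s := s + j) (by simpa using hj)
  have hre : -K ≤ s.re := by
    have := (abs_le.mp (Complex.abs_re_le_norm s)).1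
    linarith
  have hpow : R ^ (σ - (s + j).re) ≤ R ^ (σ + K) * (R ^ j)⁻¹ := by
    rw [← Real.rpow_natCast, ← Real.rpow_neg hR0.le, ← Real.rpow_add hR0]
    refine Real.rpow_le_rpow_of_exponent_le hR ?_
    simp
    linarith
  rw [hT, norm_mul, norm_mul, norm_pow]
  have hK : 0 ≤ K := (norm_nonneg s).trans hs
  calc ‖y‖ ^ j * (‖negBinom s j‖ * ‖dirichletSum a l (s + j)‖)
      ≤ ‖y‖ ^ j * (absBinom K j * ((R ^ (σ + K) * (R ^ j)⁻¹) * ∑' m, a m * l m ^ (-σ))) := by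
        gcongr
        · exact absBinom_nonneg hK j
        · exact norm_negBinom_le hs j
        · exact hD.trans (by gcongr)
    _ = _ := by rw [div_pow]; field_simp

/-- The part of the expansion with large index is holomorphic near a given point. -/
theorem shiftExpansion_tail (ha : ∀ m, 0 ≤ a m) (hR : 1 ≤ R) (hl : ∀ m, R ≤ l m)
    (hb : ∀ σ, b < σ → Summable fun m => a m * l m ^ (-σ))
    (hT : ∀ (j : ℕ) (s : ℂ), b < s.re + j → T j s = negBinom s j * dirichletSum a l (s + j))
    {y : ℂ} (hy : ‖y‖ < R) (s₀ : ℂ) :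
    ∃ J : ℕ, ∃ u : ℕ → ℝ, Summable u ∧
      (∀ j, DifferentiableOn ℂ (fun s => y ^ (j + J) * T (j + J) s) (Metric.ball s₀ 1)) ∧
      ∀ j, ∀ s ∈ Metric.ball s₀ 1, ‖y ^ (j + J) * T (j + J) s‖ ≤ u j := by
  set K := ‖s₀‖ + 1 with hK
  -- Since `s.re ≥ -K` on the ball, every `s + j` with `j ≥ J` has real part at least `b + 1`,
  -- inside the half-plane of convergence.
  obtain ⟨J, hJ⟩ := exists_nat_ge (b + 1 + K)
  have hnorm : ∀ s ∈ Metric.ball s₀ 1, ‖s‖ ≤ K := fun s hs => by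
    have := norm_le_norm_add_norm_sub' s s₀
    rw [mem_ball_iff_norm] at hs
    linarith
  have hre : ∀ s ∈ Metric.ball s₀ 1, ∀ j : ℕ, b + 1 ≤ s.re + ((j + J : ℕ) : ℝ) := fun s hs j => by
    have h1 := (abs_le.mp (Complex.abs_re_le_norm s)).1
    have h2 := hnorm s hs
    have h3 : (0 : ℝ) ≤ j := Nat.cast_nonneg j
    push_cast
    linarith
  have hσ := hb (b + 1) (lt_add_one b)
  have hσ' := hb (b + 1 / 2) (by linarith)
  refine ⟨J, fun j => (R ^ (b + 1 + K) * ∑' m, a m * l m ^ (-(b + 1))) *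
    (absBinom K (j + J) * (‖y‖ / R) ^ (j + J)), ?_, fun j => ?_, fun j s hs => ?_⟩
  · refine Summable.mul_left _ ((summable_nat_add_iff
      (f := fun j => absBinom K j * (‖y‖ / R) ^ j) J).mpr ?_)
    exact summable_absBinom (by positivity) (by positivity)
      ((div_lt_one (by linarith)).mpr hy)
  · refine DifferentiableOn.const_mul (DifferentiableOn.congr (f := fun s =>
      negBinom s (j + J) * dirichletSum a l (s + (j + J : ℕ))) ?_ fun s hs => ?_) _
    · refine (differentiable_negBinom _).differentiableOn.mul ?_
      refine (differentiableOn_dirichletSum ha hR hl hσ').comp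
        (by fun_prop) fun s hs => ?_
      have := hre s hs j
      simp only [Set.mem_ofPred_eq, Complex.add_re, Complex.natCast_re]
      linarith
    · exact hT _ _ (by linarith [hre s hs j])
  · exact norm_shiftCoeff_le ha hR hl hσ (hnorm s hs) (hre s hs j)
      (hT _ _ (by linarith [hre s hs j]))

/-- The continued expansion `∑ y ^ j T_j(s)`. -/
noncomputable def shiftExpansion (T : ℕ → ℂ → ℂ) (y s : ℂ) : ℂ := ∑' j, y ^ j * T j s

/-- Near any point only finitely many `T j` can be singular: the rest of the series converges
uniformly to a holomorphic function that can be differentiated termwise. -/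
theorem shiftExpansion_eventuallyEq (ha : ∀ m, 0 ≤ a m) (hR : 1 ≤ R) (hl : ∀ m, R ≤ l m)
    (hb : ∀ σ, b < σ → Summable fun m => a m * l m ^ (-σ))
    (hT : ∀ (j : ℕ) (s : ℂ), b < s.re + j → T j s = negBinom s j * dirichletSum a l (s + j))
    {y : ℂ} (hy : ‖y‖ < R) (s₀ : ℂ) :
    ∃ J : ℕ, ∃ H : ℂ → ℂ, AnalyticAt ℂ H s₀ ∧
      HasSum (fun j => y ^ (j + J) * deriv (T (j + J)) s₀) (deriv H s₀) ∧
      shiftExpansion T y =ᶠ[𝓝 s₀] fun s => ∑ j ∈ Finset.range J, y ^ j * T j s + H s := by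
  obtain ⟨J, u, hu, hd, hle⟩ := shiftExpansion_tail ha hR hl hb hT hy s₀
  have hball : Metric.ball s₀ 1 ∈ 𝓝 s₀ := Metric.ball_mem_nhds _ one_pos
  refine ⟨J, fun s => ∑' j, y ^ (j + J) * T (j + J) s, ?_, ?_, ?_⟩
  · exact (Complex.differentiableOn_tsum_of_summable_norm hu hd Metric.isOpen_ball
      hle).analyticAt hball
  · have := Complex.hasSum_deriv_of_summable_norm hu hd Metric.isOpen_ball hle
      (Metric.mem_ball_self one_pos)
    refine this.congr_fun fun j => ?_
    by_cases h0 : y ^ (j + J) = 0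
    · simp [h0]
    · exact (deriv_const_mul_field _).symm
  · filter_upwards [hball] with s hs
    have hsum : Summable fun j => y ^ (j + J) * T (j + J) s :=
      Summable.of_norm_bounded hu fun j => hle j s hs
    exact (((summable_nat_add_iff (f := fun j => y ^ j * T j s) J).mp hsum).sum_add_tsum_nat_add
      J).symm

theorem meromorphicAt_shiftExpansion (ha : ∀ m, 0 ≤ a m) (hR : 1 ≤ R) (hl : ∀ m, R ≤ l m)
    (hb : ∀ σ, b < σ → Summable fun m => a m * l m ^ (-σ))
    (hT : ∀ (j : ℕ) (s : ℂ), b < s.re + j → T j s = negBinom s j * dirichletSum a l (s + j))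
    {y : ℂ} (hy : ‖y‖ < R) {s₀ : ℂ} (hm : ∀ j, MeromorphicAt (T j) s₀) :
    MeromorphicAt (shiftExpansion T y) s₀ := by
  obtain ⟨J, H, hH, -, heq⟩ := shiftExpansion_eventuallyEq ha hR hl hb hT hy s₀
  refine MeromorphicAt.congr ?_ (heq.symm.filter_mono nhdsWithin_le_nhds)
  refine MeromorphicAt.fun_add (MeromorphicAt.fun_sum fun j _ => ?_) hH.meromorphicAt
  exact (MeromorphicAt.const _ _).fun_mul (hm j)

theorem analyticAt_shiftExpansion (ha : ∀ m, 0 ≤ a m) (hR : 1 ≤ R) (hl : ∀ m, R ≤ l m)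
    (hb : ∀ σ, b < σ → Summable fun m => a m * l m ^ (-σ))
    (hT : ∀ (j : ℕ) (s : ℂ), b < s.re + j → T j s = negBinom s j * dirichletSum a l (s + j))
    {y : ℂ} (hy : ‖y‖ < R) {s₀ : ℂ} (hm : ∀ j, AnalyticAt ℂ (T j) s₀) :
    AnalyticAt ℂ (shiftExpansion T y) s₀ := by
  obtain ⟨J, H, hH, -, heq⟩ := shiftExpansion_eventuallyEq ha hR hl hb hT hy s₀
  refine AnalyticAt.congr ?_ heq.symm
  exact (Finset.analyticAt_fun_sum _ fun j _ => analyticAt_const.fun_mul (hm j)).fun_add hH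

theorem hasSum_deriv_shiftExpansion (ha : ∀ m, 0 ≤ a m) (hR : 1 ≤ R) (hl : ∀ m, R ≤ l m)
    (hb : ∀ σ, b < σ → Summable fun m => a m * l m ^ (-σ))
    (hT : ∀ (j : ℕ) (s : ℂ), b < s.re + j → T j s = negBinom s j * dirichletSum a l (s + j))
    {y : ℂ} (hy : ‖y‖ < R) {s₀ : ℂ} (hm : ∀ j, AnalyticAt ℂ (T j) s₀) :
    HasSum (fun j => y ^ j * deriv (T j) s₀) (deriv (shiftExpansion T y) s₀) := by
  obtain ⟨J, H, hH, hsum, heq⟩ := shiftExpansion_eventuallyEq ha hR hl hb hT hy s₀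
  rw [heq.deriv_eq, deriv_fun_add
    (DifferentiableAt.fun_sum fun j _ => (hm j).differentiableAt.const_mul _)
    hH.differentiableAt, deriv_fun_sum fun j _ => (hm j).differentiableAt.const_mul _]
  simp only [deriv_const_mul_field]
  rw [add_comm]
  exact (hasSum_nat_add_iff J).mp hsum

/-- The derivative of the continued expansion is holomorphic in the shift. -/
theorem differentiableOn_deriv_shiftExpansion (ha : ∀ m, 0 ≤ a m) (hR : 1 ≤ R)
    (hl : ∀ m, R ≤ l m) (hb : ∀ σ, b < σ → Summable fun m => a m * l m ^ (-σ))
    (hT : ∀ (j : ℕ) (s : ℂ), b < s.re + j → T j s = negBinom s j * dirichletSum a l (s + j))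
    {s₀ : ℂ} (hm : ∀ j, AnalyticAt ℂ (T j) s₀) :
    DifferentiableOn ℂ (fun y => deriv (shiftExpansion T y) s₀) (Metric.ball 0 R) := by
  intro y hy
  rw [mem_ball_zero_iff] at hy
  -- The differentiated series converges absolutely at the shift `r`, and its terms there dominate
  -- those on the disc of radius `r`.
  obtain ⟨r, hr1, hr2⟩ := exists_between hy
  have hr0 : 0 ≤ r := (norm_nonneg y).trans hr1.le
  have hs := (hasSum_deriv_shiftExpansion ha hR hl hb hT (y := (r : ℂ))
    (by rwa [Complex.norm_real, Real.norm_of_nonneg hr0]) hm).summable.norm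
  have hd : DifferentiableOn ℂ (fun y => ∑' j, y ^ j * deriv (T j) s₀) (Metric.ball 0 r) := by
    refine Complex.differentiableOn_tsum_of_summable_norm hs (fun j => by fun_prop)
      Metric.isOpen_ball fun j z hz => ?_
    rw [mem_ball_zero_iff] at hz
    rw [norm_mul, norm_mul, norm_pow, norm_pow, Complex.norm_real, Real.norm_of_nonneg hr0]
    gcongr
  have hmem : Metric.ball (0 : ℂ) r ∈ 𝓝 y := Metric.isOpen_ball.mem_nhds (by simpa using hr1)
  refine DifferentiableAt.differentiableWithinAt ((hd.differentiableAt hmem).congr_of_eventuallyEq ?_)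
  filter_upwards [hmem] with z hz
  rw [mem_ball_zero_iff] at hz
  exact (hasSum_deriv_shiftExpansion ha hR hl hb hT (hz.trans hr2) hm).tsum_eq.symm

end Continuation

end ShiftedDirichletSeries

/-! ### Coefficients of the expansion through the Riemann zeta function. -/

section ZetaContinuation

open Filter Topology

/-- Functions in normal form that agree on a punctured neighbourhood also agree at the centre;
passing to normal form thus fills removable singularities. -/
theorem toMeromorphicNFOn_eventuallyEq_of_analyticAt {f g : ℂ → ℂ} {z : ℂ}
    (hf : MeromorphicOn f Set.univ) (hg : AnalyticAt ℂ g z) (hfg : f =ᶠ[𝓝[≠] z] g) :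
    toMeromorphicNFOn f Set.univ =ᶠ[𝓝 z] g :=
  ((meromorphicNFOn_toMeromorphicNFOn f Set.univ
    (Set.mem_univ z)).eventuallyEq_nhdsNE_iff_eventuallyEq_nhds hg.meromorphicNFAt).mp
    ((hf.toMeromorphicNFOn_eq_self_on_nhdsNE (Set.mem_univ z)).trans hfg)

/-- The entire function `s ζ(s + 1)`. -/
noncomputable def mulRiemannZeta : ℂ → ℂ :=
  Function.update (fun s => s * riemannZeta (s + 1)) 0 1

theorem mulRiemannZeta_of_ne_zero {s : ℂ} (hs : s ≠ 0) :
    mulRiemannZeta s = s * riemannZeta (s + 1) := Function.update_of_ne hs _ _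

theorem analyticAt_riemannZeta {s : ℂ} (hs : s ≠ 1) : AnalyticAt ℂ riemannZeta s := by
  have h : DifferentiableOn ℂ riemannZeta {1}ᶜ := fun z hz =>
    (differentiableAt_riemannZeta hz).differentiableWithinAt
  exact h.analyticAt (isOpen_compl_singleton.mem_nhds hs)

theorem analyticAt_mulRiemannZeta_zero : AnalyticAt ℂ mulRiemannZeta 0 := by
  refine Complex.analyticAt_of_differentiable_on_punctured_nhds_of_continuousAt ?_ ?_
  · filter_upwards [self_mem_nhdsWithin] with s hs
    have h1 : DifferentiableAt ℂ (fun s => s * riemannZeta (s + 1)) s := by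
      have h2 : s + 1 ≠ 1 := by simpa using hs
      exact differentiableAt_id.mul ((differentiableAt_riemannZeta h2).comp s (by fun_prop))
    refine h1.congr_of_eventuallyEq ?_
    filter_upwards [isOpen_compl_singleton.mem_nhds hs] with z hz
    exact mulRiemannZeta_of_ne_zero hz
  · rw [mulRiemannZeta, continuousAt_update_same]
    have h := riemannZeta_residue_one
    have h3 : Tendsto (fun s : ℂ => s + 1) (𝓝[≠] 0) (𝓝[≠] 1) := by
      refine tendsto_nhdsWithin_of_tendsto_nhds_of_eventually_within _ ?_ ?_
      · have : Tendsto (fun s : ℂ => s + 1) (𝓝 0) (𝓝 (0 + 1)) := by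
          exact (continuous_add_const 1).tendsto 0
        rw [zero_add] at this
        exact this.mono_left nhdsWithin_le_nhds
      · filter_upwards [self_mem_nhdsWithin] with s hs
        simpa using hs
    simpa [Function.comp_def] using h.comp h3

theorem meromorphicAt_riemannZeta (s : ℂ) : MeromorphicAt riemannZeta s := by
  by_cases hs : s = 1
  · subst hs
    have h : MeromorphicAt (fun s : ℂ => mulRiemannZeta (s - 1) / (s - 1)) 1 := by
      refine MeromorphicAt.fun_div (AnalyticAt.meromorphicAt ?_) (by fun_prop)
      exact AnalyticAt.fun_comp (by simpa using analyticAt_mulRiemannZeta_zero) (by fun_prop)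
    refine h.congr ?_
    filter_upwards [self_mem_nhdsWithin] with z hz
    have : z - 1 ≠ 0 := sub_ne_zero.mpr hz
    rw [mulRiemannZeta_of_ne_zero this]
    field_simp
    simp
  · exact (analyticAt_riemannZeta hs).meromorphicAt

/-- The number of `k ∈ ℕ ^ (d + 1)` with sum `m`, as a real number. -/
noncomputable def simplexCount (d m : ℕ) : ℝ := ((m + d).choose d : ℝ)

theorem simplexCount_nonneg (d m : ℕ) : 0 ≤ simplexCount d m := Nat.cast_nonneg _

theorem simplexCount_le (d m : ℕ) :
    simplexCount d (m + 1) ≤ (d + 1) ^ d * ((m + 1 : ℕ) : ℝ) ^ d := by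
  rw [simplexCount, ← mul_pow]
  have h1 : (m + 1 + d).choose d ≤ (m + 1 + d) ^ d := Nat.choose_le_pow _ _
  have h2 : m + 1 + d ≤ (d + 1) * (m + 1) := by nlinarith
  exact_mod_cast h1.trans (Nat.pow_le_pow_left h2 d)

theorem exists_polynomial_simplexCount (d : ℕ) : ∃ P : Polynomial ℂ, P.natDegree ≤ d ∧
    ∀ m : ℕ, P.eval (m : ℂ) = simplexCount d m := by
  refine ⟨Polynomial.C ((d.factorial : ℂ)⁻¹) *
    (ascPochhammer ℂ d).comp (Polynomial.X + Polynomial.C 1), ?_, fun m => ?_⟩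
  · refine (Polynomial.natDegree_C_mul_le _ _).trans ?_
    rw [Polynomial.natDegree_comp, Polynomial.natDegree_X_add_C, ascPochhammer_natDegree, mul_one]
  · have h := Nat.ascFactorial_eq_factorial_mul_choose m d
    rw [← ascPochhammer_nat_eq_ascFactorial] at h
    have h2 : (ascPochhammer ℂ d).eval ((m : ℂ) + 1) = d.factorial * (m + d).choose d := by
      have := ascPochhammer_eval_cast (S := ℂ) d (m + 1)
      rw [h] at this
      exact_mod_cast this.symm
    have hf : (d.factorial : ℂ) ≠ 0 := Nat.cast_ne_zero.mpr d.factorial_ne_zero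
    simp only [Polynomial.eval_mul, Polynomial.eval_C, Polynomial.eval_comp, Polynomial.eval_add,
      Polynomial.eval_X, simplexCount, Complex.ofReal_natCast]
    rw [h2]
    field_simp

theorem summable_simplexCount (d k : ℕ) {σ : ℝ} (hσ : (d + 1 : ℝ) < σ) :
    Summable fun m : ℕ => simplexCount d (m + k + 1) * (4 * ((m + k + 1 : ℕ) : ℝ)) ^ (-σ) := by
  have h1 : Summable fun m : ℕ => (m : ℝ) ^ (d - σ) := Real.summable_nat_rpow.mpr (by linarith)
  have h2 := ((summable_nat_add_iff (k + 1)).mpr h1).mul_left ((d + 1 : ℝ) ^ d)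
  refine Summable.of_nonneg_of_le (fun m => ?_) (fun m => ?_) h2
  · exact mul_nonneg (simplexCount_nonneg _ _) (by positivity)
  · have hm : (0 : ℝ) < ((m + k + 1 : ℕ) : ℝ) := by positivity
    calc simplexCount d (m + k + 1) * (4 * ((m + k + 1 : ℕ) : ℝ)) ^ (-σ)
        ≤ ((d + 1) ^ d * ((m + k + 1 : ℕ) : ℝ) ^ d) * ((m + k + 1 : ℕ) : ℝ) ^ (-σ) := by
          refine mul_le_mul (simplexCount_le d (m + k)) ?_ (by positivity) (by positivity)
          exact Real.rpow_le_rpow_of_nonpos hm (by linarith)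
            (by have := Nat.cast_nonneg (α := ℝ) d; linarith)
      _ = _ := by
          rw [mul_assoc, ← Real.rpow_natCast (((m + k + 1 : ℕ) : ℝ)), ← Real.rpow_add hm]
          rfl

/-- The coefficients of the tail of the base series. -/
noncomputable def tailCoeff (d k : ℕ) : ℕ → ℝ := fun m => simplexCount d (m + k + 1)

/-- The frequencies of the tail of the base series. -/
noncomputable def tailFreq (k : ℕ) : ℕ → ℝ := fun m => 4 * ((m + k + 1 : ℕ) : ℝ)

/-- The coefficient is a polynomial in the index, so each of its monomials contributes a shifted
zeta function. The index starts at `1` because the frequency `0` has no Dirichlet term. -/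
theorem hasSum_zeta_simplexCount {d : ℕ} {P : Polynomial ℂ} (hP : P.natDegree ≤ d)
    (hPm : ∀ m : ℕ, P.eval (m : ℂ) = simplexCount d m) {s : ℂ} (hs : (d + 1 : ℝ) < s.re) :
    HasSum (fun m : ℕ => (simplexCount d (m + 1) : ℂ) * ((4 * ((m + 1 : ℕ) : ℝ) : ℝ) : ℂ) ^ (-s))
      ((4 : ℂ) ^ (-s) * ∑ i ∈ Finset.range (d + 1), P.coeff i * riemannZeta (s - i)) := by
  have hz (i : ℕ) (hi : i ∈ Finset.range (d + 1)) :
      HasSum (fun m : ℕ => P.coeff i * (1 / ((m : ℂ) + 1) ^ (s - i)))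
        (P.coeff i * riemannZeta (s - i)) := by
    have hi' : (i : ℝ) ≤ d := by exact_mod_cast Finset.mem_range_succ_iff.mp hi
    have h1 : 1 < (s - i).re := by simp; linarith
    rw [zeta_eq_tsum_one_div_nat_add_one_cpow h1]
    refine (Summable.hasSum ?_).mul_left _
    have := (summable_nat_add_iff 1).mpr (Complex.summable_one_div_nat_cpow.mpr h1)
    simpa using this
  refine ((hasSum_sum hz).mul_left ((4 : ℂ) ^ (-s))).congr_fun fun m => ?_
  have hm : ((m : ℂ) + 1) ≠ 0 := Nat.cast_add_one_ne_zero m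
  rw [← hPm, Complex.ofReal_mul, Complex.mul_cpow_ofReal_nonneg (by norm_num) (by positivity),
    Polynomial.eval_eq_sum_range' (Nat.lt_succ_of_le hP), mul_left_comm, Finset.sum_mul]
  push_cast
  congr 1
  refine Finset.sum_congr rfl fun i _ => ?_
  rw [Complex.cpow_sub _ _ hm, Complex.cpow_neg, Complex.cpow_natCast]
  field_simp

/-- The tail series `D` continues to `ℂ` with at most simple poles, at `1, …, d + 1`. A pole of `D
(s + j)` at `s = 0` therefore needs `j ≥ 1`, and then `negBinom s j` contains the factor `-s`. -/
theorem exists_shiftCoeff (d k : ℕ) : ∃ T : ℕ → ℂ → ℂ,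
    (∀ j, MeromorphicOn (T j) Set.univ) ∧ (∀ j, AnalyticAt ℂ (T j) 0) ∧
    ∀ (j : ℕ) (s : ℂ), (d + 1 : ℝ) < s.re + j →
      T j s = negBinom s j * dirichletSum (tailCoeff d k) (tailFreq k) (s + j) := by
  obtain ⟨P, hP, hPm⟩ := exists_polynomial_simplexCount d
  set B : ℂ → ℂ := fun s => ∑ m ∈ Finset.range k,
    (simplexCount d (m + 1) : ℂ) * ((4 * ((m + 1 : ℕ) : ℝ) : ℝ) : ℂ) ^ (-s) with hB
  set D : ℂ → ℂ := fun s =>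
    (4 : ℂ) ^ (-s) * ∑ i ∈ Finset.range (d + 1), P.coeff i * riemannZeta (s - i) - B s with hD
  have hBd : Differentiable ℂ B := by
    refine Differentiable.fun_sum fun m _ => ?_
    have : ((4 * ((m + 1 : ℕ) : ℝ) : ℝ) : ℂ) ≠ 0 := by
      exact_mod_cast (show 4 * (m + 1) ≠ 0 by positivity)
    exact (Differentiable.const_cpow (by fun_prop) (Or.inl this)).const_mul _
  have h4 : Differentiable ℂ fun s : ℂ => (4 : ℂ) ^ (-s) :=
    Differentiable.const_cpow (by fun_prop) (Or.inl (by norm_num))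
  have hDsum (s : ℂ) (hs : (d + 1 : ℝ) < s.re) :
      D s = dirichletSum (tailCoeff d k) (tailFreq k) s := by
    have h := hasSum_zeta_simplexCount hP hPm hs
    have h2 := h.summable.sum_add_tsum_nat_add k
    rw [h.tsum_eq] at h2
    rw [hD, hB]
    simp only [← h2, add_sub_cancel_left]
    rfl
  have hDmero : ∀ s, MeromorphicAt D s := fun s => by
    refine MeromorphicAt.fun_sub (MeromorphicAt.fun_mul (h4.analyticAt s).meromorphicAt
      (MeromorphicAt.fun_sum fun i _ => (MeromorphicAt.const _ _).fun_mul ?_))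
      (hBd.analyticAt s).meromorphicAt
    exact MeromorphicAt.comp_analyticAt (g := fun s => s - (i : ℂ))
      (meromorphicAt_riemannZeta (s - i)) (by fun_prop)
  have hDan (s : ℂ) (hs : ∀ i ∈ Finset.range (d + 1), s - i ≠ 1) : AnalyticAt ℂ D s := by
    refine ((h4.analyticAt s).fun_mul (Finset.analyticAt_fun_sum _ fun i hi =>
      analyticAt_const.fun_mul ?_)).fun_sub (hBd.analyticAt s)
    exact (analyticAt_riemannZeta (hs i hi)).fun_comp (f := fun s => s - (i : ℂ)) (by fun_prop)
  set T : ℕ → ℂ → ℂ := fun j s => negBinom s j * D (s + j) with hT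
  have hTm (j : ℕ) : MeromorphicOn (T j) Set.univ := fun s _ => by
    refine ((differentiable_negBinom j).analyticAt s).meromorphicAt.fun_mul ?_
    exact MeromorphicAt.comp_analyticAt (g := fun s => s + (j : ℂ)) (hDmero (s + j)) (by fun_prop)
  have hzeta (j i : ℕ) : ∃ g : ℂ → ℂ, AnalyticAt ℂ g 0 ∧
      (fun s => s * riemannZeta (s + j - i)) =ᶠ[𝓝[≠] 0] g := by
    by_cases hij : (j : ℂ) - i = 1
    · refine ⟨mulRiemannZeta, analyticAt_mulRiemannZeta_zero, ?_⟩
      filter_upwards [self_mem_nhdsWithin] with s hs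
      rw [mulRiemannZeta_of_ne_zero hs, add_sub_assoc, hij]
    · refine ⟨_, analyticAt_id.fun_mul ?_, EventuallyEq.rfl⟩
      exact (analyticAt_riemannZeta (by simpa using hij)).fun_comp
        (f := fun s => s + (j : ℂ) - i) (by fun_prop)
  have hsD (j : ℕ) : ∃ g : ℂ → ℂ, AnalyticAt ℂ g 0 ∧
      (fun s => s * D (s + j)) =ᶠ[𝓝[≠] 0] g := by
    choose g hg hge using hzeta j
    refine ⟨fun s => (4 : ℂ) ^ (-(s + j)) * ∑ i ∈ Finset.range (d + 1), P.coeff i * g i s -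
      s * B (s + j), ?_, ?_⟩
    · refine AnalyticAt.fun_sub (AnalyticAt.fun_mul ?_ (Finset.analyticAt_fun_sum _ fun i _ =>
        analyticAt_const.fun_mul (hg i))) (analyticAt_id.fun_mul ?_)
      · exact Differentiable.analyticAt (h4.comp (differentiable_id.add_const (j : ℂ))) 0
      · exact Differentiable.analyticAt (hBd.comp (differentiable_id.add_const (j : ℂ))) 0
    · have hall : ∀ᶠ s in 𝓝[≠] (0 : ℂ), ∀ i ∈ Finset.range (d + 1),
          s * riemannZeta (s + j - i) = g i s :=
        (Finset.eventually_all _).mpr fun i _ => hge i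
      filter_upwards [hall] with s hs
      rw [← Finset.sum_congr rfl fun i hi => congrArg (P.coeff i * ·) (hs i hi)]
      simp only [hD, mul_sub, mul_left_comm s, Finset.mul_sum]
  -- At a cancelled pole the product `T j` takes its value at `0` from the default value of
  -- `riemannZeta 1`; the normal form replaces it by the limit.
  refine ⟨fun j => toMeromorphicNFOn (T j) Set.univ,
    fun j => (meromorphicNFOn_toMeromorphicNFOn _ _).meromorphicOn, fun j => ?_, fun j s hs => ?_⟩
  · have : ∃ g : ℂ → ℂ, AnalyticAt ℂ g 0 ∧ T j =ᶠ[𝓝[≠] 0] g := by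
      cases j with
      | zero =>
        refine ⟨T 0, ((differentiable_negBinom 0).analyticAt 0).fun_mul ?_, EventuallyEq.rfl⟩
        refine AnalyticAt.fun_comp (f := fun s : ℂ => s + ((0 : ℕ) : ℂ)) (hDan _ fun i _ h => ?_)
          (by fun_prop)
        have := congrArg Complex.re h
        simp at this
        linarith [Nat.cast_nonneg (α := ℝ) i]
      | succ j =>
        obtain ⟨g, hg, hge⟩ := hsD (j + 1)
        -- The factor of index `0` in `negBinom s (j + 1)` is `-s`; its `s` has been absorbed into
        -- `g`.
        refine ⟨fun s => -(∏ i ∈ Finset.range j, (-s - (i + 1 : ℕ)) / (((i + 1 : ℕ) : ℂ) + 1)) * g s,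
          AnalyticAt.fun_mul (Differentiable.analyticAt (by fun_prop) 0) hg, ?_⟩
        filter_upwards [hge] with s hs
        rw [← hs, hT]
        simp only [negBinom, Finset.prod_range_succ']
        push_cast
        ring
    obtain ⟨g, hg, hge⟩ := this
    exact hg.congr (toMeromorphicNFOn_eventuallyEq_of_analyticAt (hTm j) hg hge).symm
  · have hs' : (d + 1 : ℝ) < (s + j).re := by simpa using hs
    have han : AnalyticAt ℂ (T j) s := by
      refine ((differentiable_negBinom j).analyticAt s).fun_mul
        (AnalyticAt.fun_comp (f := fun s : ℂ => s + (j : ℂ)) (hDan _ fun i hi h => ?_) (by fun_prop))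
      have hi' : (i : ℝ) ≤ d := by exact_mod_cast Finset.mem_range_succ_iff.mp hi
      have := congrArg Complex.re h
      simp at this hs'
      linarith
    change toMeromorphicNFOn (T j) Set.univ s = _
    rw [(toMeromorphicNFOn_eventuallyEq_of_analyticAt (hTm j) han EventuallyEq.rfl).eq_of_nhds,
      ← hDsum _ hs']

end ZetaContinuation

/-! ### The base series and its entire reciprocal gamma function. -/

section BaseContinuation

open Filter Topology

theorem isMeromorphicContinuation_toMeromorphicNFOn {F f : ℂ → ℂ} {c : ℝ}
    (hf : MeromorphicOn f Set.univ) (ha : ∀ w : ℂ, c < w.re → AnalyticAt ℂ f w)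
    (hF : ∀ w : ℂ, c < w.re → f w = F w) :
    IsMeromorphicContinuation F (toMeromorphicNFOn f Set.univ) :=
  ⟨meromorphicNFOn_toMeromorphicNFOn _ _, c, fun w hw => by
    rw [(toMeromorphicNFOn_eventuallyEq_of_analyticAt hf (ha w hw) EventuallyEq.rfl).eq_of_nhds,
      hF w hw]⟩

theorem meromorphicContinuation_eq {F g : ℂ → ℂ} (h : IsMeromorphicContinuation F g) :
    meromorphicContinuation F = g := by
  have hex : ∃ g, IsMeromorphicContinuation F g := ⟨g, h⟩
  rw [meromorphicContinuation, dif_pos hex]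
  exact hex.choose_spec.unique h

/-- `M` continues the function given by `F` on the half-plane `c < Re w` to `ℂ`, and is holomorphic
on that half-plane and at `0`. -/
structure ContinuesRegularly (F M : ℂ → ℂ) (c : ℝ) : Prop where
  meromorphicOn : MeromorphicOn M Set.univ
  analyticAt_zero : AnalyticAt ℂ M 0
  analyticAt : ∀ w : ℂ, c < w.re → AnalyticAt ℂ M w
  eq : ∀ w : ℂ, c < w.re → M w = F w

theorem ContinuesRegularly.meromorphicContinuation_eventuallyEq {F M : ℂ → ℂ} {c : ℝ}
    (h : ContinuesRegularly F M c) : meromorphicContinuation F =ᶠ[𝓝 0] M := by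
  rw [meromorphicContinuation_eq
    (isMeromorphicContinuation_toMeromorphicNFOn h.meromorphicOn h.analyticAt h.eq)]
  exact toMeromorphicNFOn_eventuallyEq_of_analyticAt h.meromorphicOn h.analyticAt_zero
    EventuallyEq.rfl

theorem ContinuesRegularly.meromorphicContinuation_apply {F M : ℂ → ℂ} {c : ℝ}
    (h : ContinuesRegularly F M c) {w : ℂ} (hw : c < w.re) : meromorphicContinuation F w = F w := by
  rw [meromorphicContinuation_eq
    (isMeromorphicContinuation_toMeromorphicNFOn h.meromorphicOn h.analyticAt h.eq),
    (toMeromorphicNFOn_eventuallyEq_of_analyticAt h.meromorphicOn (h.analyticAt w hw)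
      EventuallyEq.rfl).eq_of_nhds, h.eq w hw]

theorem ContinuesRegularly.meromorphicNFOn {F M : ℂ → ℂ} {c : ℝ}
    (h : ContinuesRegularly F M c) : MeromorphicNFOn (meromorphicContinuation F) Set.univ := by
  rw [meromorphicContinuation_eq
    (isMeromorphicContinuation_toMeromorphicNFOn h.meromorphicOn h.analyticAt h.eq)]
  exact meromorphicNFOn_toMeromorphicNFOn _ _

/-- Both functions coincide near `0` with the unique meromorphic continuation. This lets
constructions that cut off different numbers of terms be compared. -/
theorem ContinuesRegularly.deriv_eq {F M M' : ℂ → ℂ} {c : ℝ} (h : ContinuesRegularly F M c)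
    (h' : ContinuesRegularly F M' c) : deriv M 0 = deriv M' 0 :=
  (h.meromorphicContinuation_eventuallyEq.symm.trans
    h'.meromorphicContinuation_eventuallyEq).deriv_eq

/-- The base series `∑ binom(m + d, d) (4 m + y) ^ (-w)`. -/
noncomputable def baseSeries (d : ℕ) (y w : ℂ) : ℂ :=
  ∑' m : ℕ, (simplexCount d m : ℂ) * (4 * m + y) ^ (-w)

theorem tailFreq_ge (k m : ℕ) : 4 * ((k : ℝ) + 1) ≤ tailFreq k m := by
  have : (0 : ℝ) ≤ m := Nat.cast_nonneg m
  simp only [tailFreq]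
  push_cast
  linarith

theorem four_mul_add_ne_zero {y : ℂ} (hy : 0 < y.re) (m : ℕ) : 4 * (m : ℂ) + y ≠ 0 := fun h => by
  have := congrArg Complex.re h
  simp at this
  linarith [Nat.cast_nonneg (α := ℝ) m]

/-- The continuation of the base series, for shifts in a disc whose radius depends on `k`. -/
theorem continuesRegularly_baseSeries (d k : ℕ) :
    ∃ g : ℂ → ℂ, DifferentiableOn ℂ g (Metric.ball 0 (4 * (k + 1))) ∧
      (∀ y, g y = 0 → ∃ m : ℕ, y = -(4 * m)) ∧
      ∀ y ∈ Metric.ball (0 : ℂ) (4 * (k + 1)), 0 < y.re →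
        ∃ M : ℂ → ℂ, ContinuesRegularly (baseSeries d y) M (d + 1) ∧
          (∀ w : ℂ, (d + 1 : ℝ) < w.re →
            Summable fun m : ℕ => (simplexCount d m : ℂ) * (4 * m + y) ^ (-w)) ∧
          Complex.exp (-deriv M 0) = g y := by
  obtain ⟨T, hTm, hT0, hT⟩ := exists_shiftCoeff d k
  have ha (m) : 0 ≤ tailCoeff d k m := simplexCount_nonneg _ _
  have hR : (1 : ℝ) ≤ 4 * (k + 1) := by linarith [Nat.cast_nonneg (α := ℝ) k]
  have hl := tailFreq_ge k
  have hb (σ : ℝ) (hσ : (d + 1 : ℝ) < σ) :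
      Summable fun m => tailCoeff d k m * tailFreq k m ^ (-σ) := summable_simplexCount d k hσ
  -- The first `k + 1` terms have derivative `-binom(m+d, d) log(4m + y)` at `0`; exponentiating its
  -- negative gives a polynomial free of branches. The remaining frequencies are at least `4(k +
  -- 1)`, which is the radius of the disc.
  refine ⟨fun y => (∏ m ∈ Finset.range (k + 1), (4 * (m : ℂ) + y) ^ (m + d).choose d) *
    Complex.exp (-deriv (shiftExpansion T y) 0), ?_, fun y hy => ?_, fun y hy hre => ?_⟩
  · refine DifferentiableOn.mul (Differentiable.differentiableOn (by fun_prop)) ?_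
    exact (differentiableOn_deriv_shiftExpansion ha hR hl hb hT hT0).neg.cexp
  · rcases mul_eq_zero.mp hy with h | h
    · obtain ⟨m, -, hm⟩ := Finset.prod_eq_zero_iff.mp h
      exact ⟨m, by linear_combination eq_zero_of_pow_eq_zero hm⟩
    · exact absurd h (Complex.exp_ne_zero _)
  · rw [mem_ball_zero_iff] at hy
    set A : ℂ → ℂ := fun w => ∑ m ∈ Finset.range (k + 1),
      (simplexCount d m : ℂ) * (4 * m + y) ^ (-w) with hA
    have hAd : Differentiable ℂ A := Differentiable.fun_sum fun m _ =>
      (Differentiable.const_cpow (by fun_prop) (Or.inl (four_mul_add_ne_zero hre m))).const_mul _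
    have hsum (w : ℂ) (hw : (d + 1 : ℝ) < w.re) :
        HasSum (fun m : ℕ => (simplexCount d m : ℂ) * (4 * m + y) ^ (-w))
          (A w + shiftExpansion T y w) := by
      have h := hasSum_shifted_dirichletTerm ha hR hl (hb w.re hw) (s := w) le_rfl hy
      have h2 : ∑' j : ℕ, y ^ j * (negBinom w j *
          dirichletSum (tailCoeff d k) (tailFreq k) (w + j)) = shiftExpansion T y w :=
        tsum_congr fun j => by
          rw [hT j w (by linarith [Nat.cast_nonneg (α := ℝ) j])]
      rw [h2] at h
      rw [add_comm]
      refine (hasSum_nat_add_iff (k + 1)).mp (h.congr_fun fun m => ?_)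
      simp [tailCoeff, tailFreq, add_assoc]
    refine ⟨fun w => A w + shiftExpansion T y w, ⟨fun w _ => ?_, ?_, fun w hw => ?_,
      fun w hw => ?_⟩, fun w hw => (hsum w hw).summable, ?_⟩
    · exact (hAd.analyticAt w).meromorphicAt.fun_add
        (meromorphicAt_shiftExpansion ha hR hl hb hT hy fun j => hTm j w (Set.mem_univ w))
    · exact (hAd.analyticAt 0).fun_add (analyticAt_shiftExpansion ha hR hl hb hT hy hT0)
    · refine (hAd.analyticAt w).fun_add (analyticAt_shiftExpansion ha hR hl hb hT hy fun j => ?_)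
      have hopen : IsOpen {s : ℂ | (d + 1 : ℝ) < s.re} :=
        isOpen_lt continuous_const Complex.continuous_re
      obtain ⟨σ, hσ1, hσ2⟩ := exists_between hw
      have h1 : AnalyticAt ℂ (dirichletSum (tailCoeff d k) (tailFreq k)) (w + j) := by
        refine (differentiableOn_dirichletSum ha hR hl (hb σ hσ1)).analyticAt
          ((isOpen_lt continuous_const Complex.continuous_re).mem_nhds ?_)
        simp only [Set.mem_ofPred_eq, Complex.add_re, Complex.natCast_re]
        linarith [Nat.cast_nonneg (α := ℝ) j]
      have h2 : AnalyticAt ℂ (fun s : ℂ => negBinom s j *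
          dirichletSum (tailCoeff d k) (tailFreq k) (s + j)) w :=
        ((differentiable_negBinom j).analyticAt w).fun_mul
          (AnalyticAt.fun_comp (f := fun s : ℂ => s + (j : ℂ)) h1 (by fun_prop))
      refine h2.congr ?_
      filter_upwards [hopen.mem_nhds hw] with s hs
      have hs' : (d + 1 : ℝ) < s.re := hs
      rw [hT j s (by linarith [Nat.cast_nonneg (α := ℝ) j])]
    · exact (hsum w hw).tsum_eq.symm
    · have hAder : deriv A 0 = -∑ m ∈ Finset.range (k + 1),
          ((m + d).choose d : ℂ) * Complex.log (4 * m + y) := by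
        rw [hA, deriv_fun_sum fun m _ => (Differentiable.const_cpow (by fun_prop)
          (Or.inl (four_mul_add_ne_zero hre m))).differentiableAt.const_mul _,
          ← Finset.sum_neg_distrib]
        refine Finset.sum_congr rfl fun m _ => ?_
        have h1 : HasDerivAt (fun w : ℂ => (4 * (m : ℂ) + y) ^ (-w))
            ((4 * (m : ℂ) + y) ^ (-(0 : ℂ)) * Complex.log (4 * m + y) * -1) 0 :=
          (hasDerivAt_neg (0 : ℂ)).const_cpow (Or.inl (four_mul_add_ne_zero hre m))
        rw [(h1.const_mul _).deriv]
        simp [simplexCount]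
      rw [deriv_fun_add (hAd 0)
        (analyticAt_shiftExpansion ha hR hl hb hT hy hT0).differentiableAt, hAder, neg_add, neg_neg,
        Complex.exp_add, Complex.exp_sum]
      congr 1
      refine Finset.prod_congr rfl fun m _ => ?_
      rw [Complex.exp_nat_mul, Complex.exp_log (four_mul_add_ne_zero hre m)]

/-- The reciprocal gamma function attached to the base series is entire, with zeros at most at
the points `-4 m`. -/
theorem exists_entire_baseSeries (d : ℕ) :
    ∃ G : ℂ → ℂ, Differentiable ℂ G ∧ (∀ y, G y = 0 → ∃ m : ℕ, y = -(4 * m)) ∧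
      ∀ y : ℂ, 0 < y.re →
        ∃ M : ℂ → ℂ, ContinuesRegularly (baseSeries d y) M (d + 1) ∧
          (∀ w : ℂ, (d + 1 : ℝ) < w.re →
            Summable fun m : ℕ => (simplexCount d m : ℂ) * (4 * m + y) ^ (-w)) ∧
          Complex.exp (-deriv M 0) = G y := by
  choose g hgd hg0 hgM using continuesRegularly_baseSeries d
  have hcons (k l : ℕ) (hkl : k ≤ l) :
      Set.EqOn (g k) (g l) (Metric.ball 0 (4 * (k + 1))) := by
    have hsub : Metric.ball (0 : ℂ) (4 * (k + 1)) ⊆ Metric.ball 0 (4 * (l + 1)) :=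
      Metric.ball_subset_ball (by gcongr)
    -- The two functions agree in the right half-plane, where both equal `exp(-∂_w)` of the same
    -- series; the point `1` lies there and in every disc.
    refine AnalyticOnNhd.eqOn_of_preconnected_of_eventuallyEq
      ((hgd k).analyticOnNhd Metric.isOpen_ball)
      (((hgd l).mono hsub).analyticOnNhd Metric.isOpen_ball)
      (convex_ball _ _).isPreconnected (z₀ := 1) ?_ ?_
    · rw [mem_ball_zero_iff, norm_one]
      linarith [Nat.cast_nonneg (α := ℝ) k]
    · have hopen : IsOpen {s : ℂ | 0 < s.re} := isOpen_lt continuous_const Complex.continuous_re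
      have h1 : (1 : ℂ) ∈ Metric.ball (0 : ℂ) (4 * (k + 1)) := by
        rw [mem_ball_zero_iff, norm_one]
        linarith [Nat.cast_nonneg (α := ℝ) k]
      filter_upwards [Metric.isOpen_ball.mem_nhds h1,
        hopen.mem_nhds (show (0 : ℝ) < (1 : ℂ).re by simp)] with y hy hre
      obtain ⟨M, hM, -, hMe⟩ := hgM k y hy hre
      obtain ⟨M', hM', -, hMe'⟩ := hgM l y (hsub hy) hre
      rw [← hMe, ← hMe', hM.deriv_eq hM']
  have hmem (y : ℂ) : y ∈ Metric.ball (0 : ℂ) (4 * ((⌈‖y‖⌉₊ : ℝ) + 1)) := by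
    rw [mem_ball_zero_iff]
    linarith [Nat.le_ceil ‖y‖, norm_nonneg y]
  have heq (k : ℕ) (y : ℂ) (hy : y ∈ Metric.ball (0 : ℂ) (4 * ((k : ℝ) + 1))) :
      g ⌈‖y‖⌉₊ y = g k y := by
    rcases le_total ⌈‖y‖⌉₊ k with h | h
    · exact hcons _ _ h (hmem y)
    · exact (hcons _ _ h hy).symm
  refine ⟨fun y => g ⌈‖y‖⌉₊ y, fun y => ?_, fun y hy => hg0 _ _ hy, fun y hre => hgM _ y (hmem y) hre⟩
  refine ((hgd ⌈‖y‖⌉₊).differentiableAt (Metric.isOpen_ball.mem_nhds (hmem y))).congr_of_eventuallyEq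
    ?_
  filter_upwards [Metric.isOpen_ball.mem_nhds (hmem y)] with z hz
  exact heq _ z hz

end BaseContinuation

/-! ### Termwise Mellin transforms of exponential series. -/

section MellinSum

open Filter Topology MeasureTheory Set

theorem integrable_of_hasSum {α ι : Type*} [MeasurableSpace α] {μ : Measure α} [Countable ι]
    {f : ι → α → ℂ} {F : α → ℂ} (hF : AEStronglyMeasurable F μ) (hf : ∀ i, Integrable (f i) μ)
    (hsum : Summable fun i => ∫ a, ‖f i a‖ ∂μ) (hae : ∀ᵐ a ∂μ, HasSum (fun i => f i a) (F a)) :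
    Integrable F μ ∧ HasSum (fun i => ∫ a, f i a ∂μ) (∫ a, F a ∂μ) := by
  refine ⟨⟨hF, ?_⟩, ?_⟩
  · have h1 (i : ι) : ∫⁻ a, ‖f i a‖ₑ ∂μ = ENNReal.ofReal (∫ a, ‖f i a‖ ∂μ) :=
      (ofReal_integral_norm_eq_lintegral_enorm (hf i)).symm
    calc ∫⁻ a, ‖F a‖ₑ ∂μ ≤ ∫⁻ a, ∑' i, ‖f i a‖ₑ ∂μ := by
          refine lintegral_mono_ae ?_
          filter_upwards [hae] with a ha
          rw [← ha.tsum_eq]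
          exact enorm_tsum_le_tsum_enorm
      _ = ∑' i, ENNReal.ofReal (∫ a, ‖f i a‖ ∂μ) := by
          rw [lintegral_tsum fun i => (hf i).1.enorm]
          exact tsum_congr h1
      _ = ENNReal.ofReal (∑' i, ∫ a, ‖f i a‖ ∂μ) :=
          (ENNReal.ofReal_tsum_of_nonneg (fun i => integral_nonneg fun a => norm_nonneg _)
            hsum).symm
      _ < ⊤ := ENNReal.ofReal_lt_top
  · rw [integral_congr_ae (hae.mono fun a ha => ha.tsum_eq.symm)]
    exact hasSum_integral_of_summable_integral_norm hf hsum

theorem norm_cpow_mul_cexp {w p : ℂ} {t : ℝ} (ht : 0 < t) :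
    ‖(t : ℂ) ^ (w - 1) * Complex.exp (-(p * t))‖ = t ^ (w.re - 1) * Real.exp (-(p.re * t)) := by
  rw [norm_mul, Complex.norm_cpow_eq_rpow_re_of_pos ht, Complex.norm_exp]
  simp

theorem integrableOn_rpow_mul_exp {u r : ℝ} (hu : 0 < u) (hr : 0 < r) :
    IntegrableOn (fun t : ℝ => t ^ (u - 1) * Real.exp (-(r * t))) (Ioi 0) := by
  have := integrableOn_rpow_mul_exp_neg_mul_rpow (p := 1) (s := u - 1) (by linarith) one_pos hr
  simpa using this

theorem integrableOn_cpow_mul_cexp {w p : ℂ} (hw : 0 < w.re) (hp : 0 < p.re) :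
    IntegrableOn (fun t : ℝ => (t : ℂ) ^ (w - 1) * Complex.exp (-(p * t))) (Ioi 0) := by
  refine (integrableOn_rpow_mul_exp hw hp).mono' (by fun_prop) ?_
  filter_upwards [ae_restrict_mem measurableSet_Ioi] with t ht
  exact (norm_cpow_mul_cexp ht).le

theorem integral_norm_cpow_mul_cexp {w p : ℂ} (hw : 0 < w.re) (hp : 0 < p.re) :
    ∫ t : ℝ in Ioi 0, ‖(t : ℂ) ^ (w - 1) * Complex.exp (-(p * t))‖ =
      Real.Gamma w.re * p.re ^ (-w.re) := by
  rw [setIntegral_congr_fun measurableSet_Ioi fun t ht => norm_cpow_mul_cexp ht,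
    Real.integral_rpow_mul_exp_neg_mul_Ioi hw hp, mul_comm, one_div,
    Real.inv_rpow hp.le, Real.rpow_neg hp.le]

/-- The gamma integral with a complex frequency. -/
theorem integral_cpow_mul_cexp {w p : ℂ} (hw : 0 < w.re) (hp : 0 < p.re) :
    ∫ t : ℝ in Ioi 0, (t : ℂ) ^ (w - 1) * Complex.exp (-(p * t)) =
      Complex.Gamma w * p ^ (-w) := by
  have hopen : IsOpen {p : ℂ | 0 < p.re} := isOpen_lt continuous_const Complex.continuous_re
  have hd : DifferentiableOn ℂ (fun p : ℂ =>
      ∫ t : ℝ in Ioi 0, (t : ℂ) ^ (w - 1) * Complex.exp (-(p * t))) {p | 0 < p.re} := by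
    intro q hq
    have hq' : 0 < q.re := hq
    -- On this half-plane a single integrable majorant bounds the derivative in `p`.
    have hs : {p : ℂ | q.re / 2 < p.re} ∈ 𝓝 q :=
      (isOpen_lt continuous_const Complex.continuous_re).mem_nhds (half_lt_self hq')
    refine DifferentiableAt.differentiableWithinAt (HasDerivAt.differentiableAt
      (hasDerivAt_integral_of_dominated_loc_of_deriv_le
      (μ := volume.restrict (Ioi (0 : ℝ)))
      (F := fun p (t : ℝ) => (t : ℂ) ^ (w - 1) * Complex.exp (-(p * t)))
      (F' := fun p (t : ℝ) => (t : ℂ) ^ (w - 1) * (Complex.exp (-(p * t)) * -t))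
      (bound := fun t => t ^ (w.re + 1 - 1) * Real.exp (-(q.re / 2 * t))) hs
      (Eventually.of_forall fun p => by fun_prop) (integrableOn_cpow_mul_cexp hw hq')
      (by fun_prop) ?_ (integrableOn_rpow_mul_exp (by linarith) (half_pos hq')) ?_).2)
    · filter_upwards [ae_restrict_mem measurableSet_Ioi] with t ht p hp
      have ht' : 0 < t := ht
      have hp' : q.re / 2 < p.re := hp
      rw [← mul_assoc, norm_mul, norm_cpow_mul_cexp ht', norm_neg, Complex.norm_real,
        Real.norm_of_nonneg ht'.le, show w.re + 1 - 1 = (w.re - 1) + 1 by ring,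
        Real.rpow_add_one ht'.ne', mul_right_comm]
      gcongr
    · refine Eventually.of_forall fun t p _ => HasDerivAt.const_mul _ ?_
      have h1 : HasDerivAt (fun p : ℂ => -(p * t)) (-t : ℂ) p := by
        simpa using ((hasDerivAt_id p).mul_const (t : ℂ)).fun_neg
      exact h1.cexp
  have hd2 : DifferentiableOn ℂ (fun p : ℂ => Complex.Gamma w * p ^ (-w)) {p | 0 < p.re} := by
    intro q hq
    have hq' : q ∈ Complex.slitPlane := Or.inl hq
    exact ((differentiableAt_id.cpow_const hq').const_mul _).differentiableWithinAt
  have hpre : IsPreconnected {p : ℂ | 0 < p.re} := (convex_halfSpace_re_gt 0).isPreconnected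
  refine AnalyticOnNhd.eqOn_of_preconnected_of_frequently_eq (hd.analyticOnNhd hopen)
    (hd2.analyticOnNhd hopen) hpre (z₀ := 1) (by simp) ?_ hp
  have hreal (r : ℝ) (hr : 0 < r) :
      ∫ t : ℝ in Ioi 0, (t : ℂ) ^ (w - 1) * Complex.exp (-((r : ℂ) * t)) =
        Complex.Gamma w * (r : ℂ) ^ (-w) := by
    rw [Complex.integral_cpow_mul_exp_neg_mul_Ioi hw hr, mul_comm, one_div, Complex.inv_cpow,
      Complex.cpow_neg]
    rw [Complex.arg_ofReal_of_nonneg hr.le]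
    exact Real.pi_pos.ne
  -- Both sides are holomorphic in `p` and agree for real `p`; real points accumulating at `1`
  -- suffice for the identity theorem.
  have htend : Tendsto (fun n : ℕ => ((1 + 1 / ((n : ℝ) + 1) : ℝ) : ℂ)) atTop (𝓝[≠] 1) := by
    refine tendsto_nhdsWithin_of_tendsto_nhds_of_eventually_within _ ?_ ?_
    · have := (tendsto_one_div_add_atTop_nhds_zero_nat (𝕜 := ℝ)).const_add 1
      rw [add_zero] at this
      exact_mod_cast (Complex.continuous_ofReal.tendsto 1).comp this
    · refine Eventually.of_forall fun n => ?_
      have h : (0 : ℝ) < 1 / ((n : ℝ) + 1) := by positivity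
      have h2 : (1 + 1 / ((n : ℝ) + 1) : ℝ) ≠ 1 := by linarith
      exact fun h3 => h2 (Complex.ofReal_eq_one.mp h3)
  exact htend.frequently (Frequently.of_forall fun n => hreal _ (by positivity))

/-- Termwise Mellin transform of an exponential series with complex frequencies. -/
theorem hasSum_mellin_exp_series {ι : Type*} [Countable ι] {c p : ι → ℂ} {F : ℝ → ℂ} {w : ℂ}
    (hw : 0 < w.re) (hp : ∀ i, 0 < (p i).re) (hF : Measurable F)
    (hsum : Summable fun i => ‖c i‖ * (p i).re ^ (-w.re))
    (hcF : ∀ t : ℝ, 0 < t → HasSum (fun i => c i * Complex.exp (-(p i * t))) (F t)) :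
    IntegrableOn (fun t : ℝ => (t : ℂ) ^ (w - 1) * F t) (Ioi 0) ∧
      HasSum (fun i => c i * p i ^ (-w))
        ((Complex.Gamma w)⁻¹ * ∫ t : ℝ in Ioi 0, (t : ℂ) ^ (w - 1) * F t) := by
  have hG : Complex.Gamma w ≠ 0 := Complex.Gamma_ne_zero_of_re_pos hw
  have h := integrable_of_hasSum (μ := volume.restrict (Ioi (0 : ℝ)))
    (f := fun i t => c i * ((t : ℂ) ^ (w - 1) * Complex.exp (-(p i * t))))
    (F := fun t => (t : ℂ) ^ (w - 1) * F t)
    (Measurable.aestronglyMeasurable (by fun_prop))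
    (fun i => (integrableOn_cpow_mul_cexp hw (hp i)).const_mul _) ?_ ?_
  · refine ⟨h.1, (h.2.mul_left (Complex.Gamma w)⁻¹).congr_fun fun i => ?_⟩
    rw [integral_const_mul, integral_cpow_mul_cexp hw (hp i)]
    field_simp
  · refine (hsum.mul_left (Real.Gamma w.re)).congr fun i => ?_
    simp_rw [norm_mul (c i)]
    rw [integral_const_mul, integral_norm_cpow_mul_cexp hw (hp i)]
    ring
  · filter_upwards [ae_restrict_mem measurableSet_Ioi] with t ht
    refine ((hcF t ht).mul_left ((t : ℂ) ^ (w - 1))).congr_fun fun i => ?_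
    ring

theorem hasSum_prod_geometric (r : ℕ) (q : Fin r → ℂ) (hq : ∀ j, ‖q j‖ < 1) :
    HasSum (fun k : Fin r → ℕ => ∏ j, q j ^ k j) (∏ j, (1 - q j)⁻¹) ∧
      Summable fun k : Fin r → ℕ => ‖∏ j, q j ^ k j‖ := by
  induction r with
  | zero =>
    refine ⟨?_, (hasSum_fintype _).summable⟩
    simp
  | succ r ih =>
    obtain ⟨h1, h2⟩ := ih (Fin.tail q) fun j => hq _
    have hgeo := hasSum_geometric_of_norm_lt_one (hq 0)
    have hgn : Summable fun n : ℕ => ‖q 0 ^ n‖ := by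
      simpa using summable_geometric_of_lt_one (norm_nonneg _) (hq 0)
    have hs := summable_mul_of_summable_norm hgn h2
    have hprod := hgeo.mul h1 hs
    have he (x : ℕ × (Fin r → ℕ)) :
        (∏ j, q j ^ (Fin.consEquiv (fun _ : Fin (r + 1) => ℕ) x) j) =
          q 0 ^ x.1 * ∏ j, Fin.tail q j ^ x.2 j := by
      simp [Fin.prod_univ_succ, Fin.consEquiv, Fin.tail]
    constructor
    · rw [← (Fin.consEquiv fun _ : Fin (r + 1) => ℕ).hasSum_iff, Fin.prod_univ_succ]
      exact hprod.congr_fun fun x => he x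
    · rw [← (Fin.consEquiv fun _ : Fin (r + 1) => ℕ).summable_iff]
      refine (hgn.mul_norm h2).congr fun x => ?_
      simp only [Function.comp_apply]
      rw [he]

end MellinSum

/-! ### Barnes zeta and gamma functions with periods `2` and `4`. -/

section BarnesContinuation

open Filter Topology MeasureTheory Set

/-- The kernel `e^{-x t} (1 - e^{-2 t})^{-p} (1 - e^{-4 t})^{-q}`. -/
noncomputable def barnesKernel (p q : ℕ) (x : ℂ) (t : ℝ) : ℂ :=
  Complex.exp (-(x * t)) *
    ((1 - Complex.exp (-(2 * t))) ^ p * (1 - Complex.exp (-(4 * t))) ^ q)⁻¹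

theorem measurable_barnesKernel (p q : ℕ) (x : ℂ) : Measurable (barnesKernel p q x) := by
  unfold barnesKernel
  fun_prop

theorem norm_cexp_neg_mul_lt_one {r : ℝ} (hr : 0 < r) {t : ℝ} (ht : 0 < t) :
    ‖Complex.exp (-((r : ℂ) * t))‖ < 1 := by
  rw [Complex.norm_exp]
  simpa using mul_pos hr ht

theorem one_sub_cexp_neg_mul_ne_zero {r : ℝ} (hr : 0 < r) {t : ℝ} (ht : 0 < t) :
    1 - Complex.exp (-((r : ℂ) * t)) ≠ 0 := fun h => by
  have := norm_cexp_neg_mul_lt_one hr ht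
  rw [← sub_eq_zero.mp h, norm_one] at this
  exact lt_irrefl _ this

/-- Multiplying numerator and denominator by `(1 + e^{-2t})^p` turns every period into `4`, and the
binomial theorem expands the numerator. -/
theorem barnesKernel_eq_sum (p q : ℕ) (x : ℂ) {t : ℝ} (ht : 0 < t) :
    barnesKernel p q x t =
      ∑ i ∈ Finset.range (p + 1), (p.choose i : ℂ) * barnesKernel 0 (p + q) (x + 2 * i) t := by
  have h2 : 1 - Complex.exp (-(2 * t)) ≠ 0 := by
    exact_mod_cast one_sub_cexp_neg_mul_ne_zero (r := 2) two_pos ht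
  have h4 : 1 - Complex.exp (-(4 * t)) ≠ 0 := by
    exact_mod_cast one_sub_cexp_neg_mul_ne_zero (r := 4) four_pos ht
  have hfac : 1 - Complex.exp (-(4 * t)) =
      (1 - Complex.exp (-(2 * t))) * (Complex.exp (-(2 * t)) + 1) := by
    rw [show -(4 * (t : ℂ)) = -(2 * t) + -(2 * t) by ring, Complex.exp_add]
    ring
  have hterm (i : ℕ) : barnesKernel 0 (p + q) (x + 2 * i) t =
      Complex.exp (-(x * t)) * Complex.exp (-(2 * t)) ^ i *
        ((1 - Complex.exp (-(4 * t))) ^ (p + q))⁻¹ := by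
    rw [barnesKernel, pow_zero, one_mul, ← Complex.exp_nat_mul, ← Complex.exp_add]
    congr 2
    ring
  have hbin := add_pow (Complex.exp (-(2 * t))) 1 p
  simp only [one_pow, mul_one] at hbin
  calc barnesKernel p q x t
      = Complex.exp (-(x * t)) * (Complex.exp (-(2 * t)) + 1) ^ p *
        ((1 - Complex.exp (-(4 * t))) ^ (p + q))⁻¹ := by
        rw [barnesKernel, pow_add, mul_assoc]
        congr 1
        have h5 : Complex.exp (-(2 * t)) + 1 ≠ 0 := fun h => h4 (by rw [hfac, h, mul_zero])
        rw [hfac]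
        simp only [mul_pow]
        field_simp
    _ = _ := by
        rw [hbin, Finset.mul_sum, Finset.sum_mul]
        refine Finset.sum_congr rfl fun i _ => ?_
        rw [hterm]
        ring

theorem hasSum_barnesKernel (d : ℕ) (y : ℂ) {t : ℝ} (ht : 0 < t) :
    HasSum (fun m : ℕ => (simplexCount d m : ℂ) * Complex.exp (-((4 * m + y) * t)))
      (barnesKernel 0 (d + 1) y t) := by
  have h4 : ‖Complex.exp (-(4 * t))‖ < 1 := by
    exact_mod_cast norm_cexp_neg_mul_lt_one (r := 4) four_pos ht
  have h := (hasSum_choose_mul_geometric_of_norm_lt_one d h4).mul_left (Complex.exp (-(y * t)))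
  rw [barnesKernel, pow_zero, one_mul, ← one_div]
  refine h.congr_fun fun m => ?_
  rw [simplexCount, Complex.ofReal_natCast, ← Complex.exp_nat_mul, mul_left_comm,
    ← Complex.exp_add]
  congr 2
  ring

theorem mellin_barnesKernel_base (d : ℕ) {y w : ℂ} (hy : 0 < y.re) (hw : (d + 1 : ℝ) < w.re)
    (hsum : ∀ (y' w' : ℂ), 0 < y'.re → (d + 1 : ℝ) < w'.re →
      Summable fun m : ℕ => (simplexCount d m : ℂ) * (4 * m + y') ^ (-w')) :
    IntegrableOn (fun t : ℝ => (t : ℂ) ^ (w - 1) * barnesKernel 0 (d + 1) y t) (Ioi 0) ∧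
      baseSeries d y w =
        (Complex.Gamma w)⁻¹ * ∫ t : ℝ in Ioi 0, (t : ℂ) ^ (w - 1) * barnesKernel 0 (d + 1) y t := by
  have hre (m : ℕ) : (4 * (m : ℂ) + y).re = 4 * m + y.re := by simp
  have hpos (m : ℕ) : 0 < 4 * (m : ℝ) + y.re := by positivity
  have h := hasSum_mellin_exp_series (w := w) (c := fun m : ℕ => (simplexCount d m : ℂ))
    (p := fun m : ℕ => 4 * (m : ℂ) + y) (by linarith [Nat.cast_nonneg (α := ℝ) d])
    (fun m => by rw [hre]; exact hpos m) (measurable_barnesKernel 0 (d + 1) y) ?_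
    fun t ht => hasSum_barnesKernel d y ht
  · exact ⟨h.1, h.2.tsum_eq⟩
  · refine (hsum (y.re : ℂ) (w.re : ℂ) (by simpa) (by simpa)).norm.congr fun m => ?_
    rw [norm_mul, hre, show 4 * (m : ℂ) + (y.re : ℂ) = ((4 * m + y.re : ℝ) : ℂ) by push_cast; rfl,
      Complex.norm_cpow_eq_rpow_re_of_pos (hpos m)]
    simp

theorem mellin_barnesKernel {d p q : ℕ} (hpq : p + q = d + 1) {x w : ℂ} (hx : 0 < x.re)
    (hw : (d + 1 : ℝ) < w.re)
    (hsum : ∀ (y' w' : ℂ), 0 < y'.re → (d + 1 : ℝ) < w'.re →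
      Summable fun m : ℕ => (simplexCount d m : ℂ) * (4 * m + y') ^ (-w')) :
    IntegrableOn (fun t : ℝ => (t : ℂ) ^ (w - 1) * barnesKernel p q x t) (Ioi 0) ∧
      ∑ i ∈ Finset.range (p + 1), (p.choose i : ℂ) * baseSeries d (x + 2 * i) w =
        (Complex.Gamma w)⁻¹ * ∫ t : ℝ in Ioi 0, (t : ℂ) ^ (w - 1) * barnesKernel p q x t := by
  have hre (i : ℕ) : 0 < (x + 2 * (i : ℂ)).re := by
    have : (x + 2 * (i : ℂ)).re = x.re + 2 * i := by simp
    rw [this]; positivity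
  have hbase (i : ℕ) := mellin_barnesKernel_base d (hre i) hw hsum
  have heq : EqOn (fun t : ℝ => (t : ℂ) ^ (w - 1) * barnesKernel p q x t)
      (fun t : ℝ => ∑ i ∈ Finset.range (p + 1), (p.choose i : ℂ) *
        ((t : ℂ) ^ (w - 1) * barnesKernel 0 (d + 1) (x + 2 * i) t)) (Ioi 0) := fun t ht => by
    simp only [barnesKernel_eq_sum p q x ht, hpq, Finset.mul_sum]
    exact Finset.sum_congr rfl fun i _ => by ring
  have hint : ∀ i ∈ Finset.range (p + 1), IntegrableOn (fun t : ℝ => (p.choose i : ℂ) *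
      ((t : ℂ) ^ (w - 1) * barnesKernel 0 (d + 1) (x + 2 * i) t)) (Ioi 0) :=
    fun i _ => (hbase i).1.const_mul _
  refine ⟨(integrable_finsetSum _ hint).congr ?_, ?_⟩
  · filter_upwards [ae_restrict_mem measurableSet_Ioi] with t ht
    exact (heq ht).symm
  · rw [setIntegral_congr_fun measurableSet_Ioi heq, integral_finsetSum _ hint, Finset.mul_sum]
    refine Finset.sum_congr rfl fun i _ => ?_
    rw [integral_const_mul, (hbase i).2]
    ring

variable {r : ℕ} {ω : Fin r → ℝ}

/-- The hypothesis `hprod` says that the periods are `2` with multiplicity `p` and `4` with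
multiplicity `q`; it is applied to `g z = (1 - e^{-zt})⁻¹`, the sum of the geometric series of
period `z`. -/
theorem hasSum_exp_periods {p q : ℕ} (hω : ∀ j, 0 < ω j)
    (hprod : ∀ g : ℝ → ℂ, ∏ j, g (ω j) = g 2 ^ p * g 4 ^ q) (x : ℂ) {t : ℝ} (ht : 0 < t) :
    HasSum (fun k : Fin r → ℕ => Complex.exp (-(((∑ j, (k j : ℂ) * (ω j : ℂ)) + x) * t)))
      (barnesKernel p q x t) := by
  have h := ((hasSum_prod_geometric r (fun j => Complex.exp (-((ω j : ℂ) * t)))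
    fun j => norm_cexp_neg_mul_lt_one (hω j) ht).1).mul_left (Complex.exp (-(x * t)))
  have hval := hprod fun z => (1 - Complex.exp (-((z : ℂ) * t)))⁻¹
  rw [hval] at h
  rw [barnesKernel, mul_inv, ← inv_pow, ← inv_pow]
  simp only [Complex.ofReal_ofNat] at h
  refine h.congr_fun fun k => ?_
  simp only [← Complex.exp_nat_mul, ← Complex.exp_sum, ← Complex.exp_add]
  congr 1
  rw [add_mul, Finset.sum_mul, neg_add, ← Finset.sum_neg_distrib, add_comm]
  congr 1
  exact Finset.sum_congr rfl fun j _ => by ring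

theorem re_periods_pos (hω : ∀ j, 0 < ω j) {x : ℂ} (hx : 0 < x.re) (k : Fin r → ℕ) :
    ((∑ j, (k j : ℂ) * (ω j : ℂ)) + x).re = (∑ j, (k j : ℝ) * ω j) + x.re ∧
      0 < (∑ j, (k j : ℝ) * ω j) + x.re := by
  refine ⟨by simp, ?_⟩
  have : 0 ≤ ∑ j, (k j : ℝ) * ω j := Finset.sum_nonneg fun j _ =>
    mul_nonneg (Nat.cast_nonneg _) (hω j).le
  linarith

/-- Each term is a gamma integral of a positive function. Finite partial sums of the integrands are
at most the kernel at the real shift `σ`, whose Mellin integral is already known to converge, so the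
partial sums are bounded. -/
theorem summable_rpow_periods {d p q : ℕ} (hpq : p + q = d + 1) (hω : ∀ j, 0 < ω j)
    (hprod : ∀ g : ℝ → ℂ, ∏ j, g (ω j) = g 2 ^ p * g 4 ^ q)
    (hsum : ∀ (y' w' : ℂ), 0 < y'.re → (d + 1 : ℝ) < w'.re →
      Summable fun m : ℕ => (simplexCount d m : ℂ) * (4 * m + y') ^ (-w'))
    {σ u : ℝ} (hσ : 0 < σ) (hu : (d + 1 : ℝ) < u) :
    Summable fun k : Fin r → ℕ => ((∑ j, (k j : ℝ) * ω j) + σ) ^ (-u) := by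
  have hu0 : 0 < u := by linarith [Nat.cast_nonneg (α := ℝ) d]
  have hG : 0 < Real.Gamma u := Real.Gamma_pos_of_pos hu0
  have hint := (mellin_barnesKernel hpq (x := (σ : ℂ)) (w := (u : ℂ)) (by simpa) (by simpa)
    hsum).1.norm
  set f : (Fin r → ℕ) → ℝ → ℝ := fun k t =>
    t ^ (u - 1) * Real.exp (-(((∑ j, (k j : ℝ) * ω j) + σ) * t)) with hf
  have hpos (k : Fin r → ℕ) : 0 < (∑ j, (k j : ℝ) * ω j) + σ :=
    (re_periods_pos hω (x := (σ : ℂ)) (by simpa) k).2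
  have hfi (k) : IntegrableOn (f k) (Ioi 0) := integrableOn_rpow_mul_exp hu0 (hpos k)
  have hval (k) : ∫ t in Ioi 0, f k t =
      Real.Gamma u * ((∑ j, (k j : ℝ) * ω j) + σ) ^ (-u) := by
    rw [hf, Real.integral_rpow_mul_exp_neg_mul_Ioi hu0 (hpos k), mul_comm, one_div,
      Real.inv_rpow (hpos k).le, Real.rpow_neg (hpos k).le]
  have hbound (S : Finset (Fin r → ℕ)) : ∑ k ∈ S, ∫ t in Ioi 0, f k t ≤
      ∫ t : ℝ in Ioi 0, ‖(t : ℂ) ^ ((u : ℂ) - 1) * barnesKernel p q σ t‖ := by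
    rw [← integral_finsetSum _ fun k _ => hfi k]
    refine setIntegral_mono_on (integrable_finsetSum _ fun k _ => hfi k) hint measurableSet_Ioi
      fun t ht => ?_
    have ht' : 0 < t := ht
    have hs := hasSum_exp_periods hω hprod (σ : ℂ) ht'
    have hs2 : HasSum (fun k : Fin r → ℕ => Real.exp (-(((∑ j, (k j : ℝ) * ω j) + σ) * t)))
        (barnesKernel p q σ t).re := by
      refine (Complex.hasSum_re hs).congr_fun fun k => ?_
      rw [show -(((∑ j, (k j : ℂ) * (ω j : ℂ)) + (σ : ℂ)) * t) =
        ((-(((∑ j, (k j : ℝ) * ω j) + σ) * t) : ℝ) : ℂ) by push_cast; rfl,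
        Complex.exp_ofReal_re]
    rw [hf, ← Finset.mul_sum, norm_mul, Complex.norm_cpow_eq_rpow_re_of_pos ht']
    have h1 := (sum_le_hasSum S (fun k _ => (Real.exp_pos _).le) hs2).trans (Complex.re_le_norm _)
    simp only [Complex.sub_re, Complex.ofReal_re, Complex.one_re]
    gcongr
  have := summable_of_sum_le (fun k => integral_nonneg_of_ae ?_) hbound
  · refine (this.mul_left (Real.Gamma u)⁻¹).congr fun k => ?_
    rw [hval]
    field_simp
  · filter_upwards [ae_restrict_mem measurableSet_Ioi] with t ht
    exact mul_nonneg (Real.rpow_nonneg (le_of_lt ht) _) (Real.exp_pos _).le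

/-- For periods `2` (`p` times) and `4` (`q` times): the continuation of the multiple Hurwitz zeta
function, its integral representation, and the entire reciprocal of the multiple gamma function. -/
theorem exists_entire_multipleGamma_inv {d p q : ℕ} (hpq : p + q = d + 1) (hω : ∀ j, 0 < ω j)
    (hprod : ∀ g : ℝ → ℂ, ∏ j, g (ω j) = g 2 ^ p * g 4 ^ q) :
    ∃ G : ℂ → ℂ, Differentiable ℂ G ∧ (∀ x, G x = 0 → ∃ m : ℕ, x = -(2 * m)) ∧
      ∀ x : ℂ, 0 < x.re →
        (∀ w : ℂ, (d + 1 : ℝ) < w.re →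
          IntegrableOn (fun t : ℝ => (t : ℂ) ^ (w - 1) * barnesKernel p q x t) (Ioi 0) ∧
          HasSum (multipleHurwitzTerm w x ω) ((Complex.Gamma w)⁻¹ *
            ∫ t : ℝ in Ioi 0, (t : ℂ) ^ (w - 1) * barnesKernel p q x t)) ∧
        ∃ M : ℂ → ℂ, ContinuesRegularly (fun w => ∑' k, multipleHurwitzTerm w x ω k) M (d + 1) ∧
          Complex.exp (-deriv M 0) = G x := by
  obtain ⟨G, hGd, hG0, hGM⟩ := exists_entire_baseSeries d
  choose! M hM hMsum hMexp using hGM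
  have hsum : ∀ (y' w' : ℂ), 0 < y'.re → (d + 1 : ℝ) < w'.re →
      Summable fun m : ℕ => (simplexCount d m : ℂ) * (4 * m + y') ^ (-w') :=
    fun y' w' hy' hw' => hMsum y' hy' w' hw'
  -- The weights `binom(p, i)` of the kernel decomposition become exponents under `exp(-∂_w)`.
  refine ⟨fun x => ∏ i ∈ Finset.range (p + 1), G (x + 2 * i) ^ p.choose i, ?_, fun x hx => ?_,
    fun x hx => ?_⟩
  · exact Differentiable.fun_finsetProd fun i _ => (hGd.comp (by fun_prop)).pow _
  · obtain ⟨i, -, hi⟩ := Finset.prod_eq_zero_iff.mp hx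
    obtain ⟨m, hm⟩ := hG0 _ (eq_zero_of_pow_eq_zero hi)
    refine ⟨2 * m + i, ?_⟩
    push_cast
    linear_combination hm
  · have hHS (w : ℂ) (hw : (d + 1 : ℝ) < w.re) :
        IntegrableOn (fun t : ℝ => (t : ℂ) ^ (w - 1) * barnesKernel p q x t) (Ioi 0) ∧
        HasSum (multipleHurwitzTerm w x ω) ((Complex.Gamma w)⁻¹ *
          ∫ t : ℝ in Ioi 0, (t : ℂ) ^ (w - 1) * barnesKernel p q x t) := by
      have h := hasSum_mellin_exp_series (w := w) (c := fun _ : Fin r → ℕ => (1 : ℂ))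
        (p := fun k : Fin r → ℕ => (∑ j, (k j : ℂ) * (ω j : ℂ)) + x)
        (by linarith [Nat.cast_nonneg (α := ℝ) d])
        (fun k => by rw [(re_periods_pos hω hx k).1]; exact (re_periods_pos hω hx k).2)
        (measurable_barnesKernel p q x) ?_
        fun t ht => (hasSum_exp_periods hω hprod x ht).congr_fun fun k => one_mul _
      · exact ⟨h.1, h.2.congr_fun fun k => (one_mul _).symm⟩
      · refine (summable_rpow_periods hpq hω hprod hsum hx hw).congr fun k => ?_
        rw [(re_periods_pos hω hx k).1, norm_one, one_mul]
    have hre (i : ℕ) : 0 < (x + 2 * (i : ℂ)).re := by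
      have : (x + 2 * (i : ℂ)).re = x.re + 2 * i := by simp
      rw [this]; positivity
    have hMi (i : ℕ) := hM _ (hre i)
    refine ⟨hHS, fun w => ∑ i ∈ Finset.range (p + 1), (p.choose i : ℂ) * M (x + 2 * i) w,
      ⟨fun w _ => MeromorphicAt.fun_sum fun i _ => (MeromorphicAt.const _ _).fun_mul
        ((hMi i).meromorphicOn w (mem_univ w)),
      Finset.analyticAt_fun_sum _ fun i _ => analyticAt_const.fun_mul (hMi i).analyticAt_zero,
      fun w hw => Finset.analyticAt_fun_sum _ fun i _ =>
        analyticAt_const.fun_mul ((hMi i).analyticAt w hw), fun w hw => ?_⟩, ?_⟩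
    · rw [(hHS w hw).2.tsum_eq, ← (mellin_barnesKernel hpq hx hw hsum).2]
      exact Finset.sum_congr rfl fun i _ => by rw [(hMi i).eq w hw]
    · rw [deriv_fun_sum fun i _ => (hMi i).analyticAt_zero.differentiableAt.const_mul _,
        ← Finset.sum_neg_distrib, Complex.exp_sum]
      refine Finset.prod_congr rfl fun i _ => ?_
      rw [deriv_const_mul_field, ← mul_neg, Complex.exp_nat_mul, hMexp _ (hre i)]

end BarnesContinuation

/-! ### Automorphy, the absolute zeta function and the functional equation. -/

section GroverAbsoluteZeta

open Filter Topology MeasureTheory Set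

theorem groverZeta_eq_neg_one_div {n₁ n₂ p q : ℕ} (h₁ : n₁ ≠ 0) (h₂ : n₂ ≠ 0)
    (hpq : p + q = (n₁ - 1) * (n₂ - 1) + 1) (hq : n₁ - 1 + (n₂ - 1) = q) (hodd : Odd (p + q))
    (u : ℂ) : groverZeta (completeBipartiteGraph (Fin n₁) (Fin n₂)) u =
      -(1 / ((u ^ 2 - 1) ^ p * (u ^ 4 - 1) ^ q)) := by
  have h4 : u ^ 4 - 1 = (u ^ 2 - 1) * (1 + u ^ 2) := by ring
  rw [groverZeta_completeBipartiteGraph h₁ h₂, ← hpq, hq, h4, ← neg_sub (u ^ 2), hodd.neg_pow,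
    mul_pow, ← mul_assoc, ← pow_add, neg_mul, inv_neg, one_div]

/-- Each of the `p + q` factors changes sign under `x ↦ 1/x` up to a power of `x`, so the total sign
is `-1`. The computation also covers the poles, where the convention `0⁻¹ = 0` gives `0` on both
sides. -/
theorem isAbsoluteAutomorphicForm_neg_one_div {p q N : ℕ} (hN : 2 * p + 4 * q = N)
    (hodd : Odd (p + q)) {f : ℝ → ℂ}
    (hf : ∀ x : ℝ, f x = -(1 / (((x : ℂ) ^ 2 - 1) ^ p * ((x : ℂ) ^ 4 - 1) ^ q))) :
    IsAbsoluteAutomorphicForm f (-1) (-(N : ℤ)) := by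
  refine ⟨Or.inr rfl, fun x hx => ?_⟩
  have hx' : (x : ℂ) ≠ 0 := Complex.ofReal_ne_zero.mpr hx
  have e2 : ((1 / (x : ℂ)) ^ 2 - 1) = -((x : ℂ) ^ 2 - 1) / x ^ 2 := by field_simp; ring
  have e4 : ((1 / (x : ℂ)) ^ 4 - 1) = -((x : ℂ) ^ 4 - 1) / x ^ 4 := by field_simp; ring
  rw [hf, hf, neg_neg, zpow_natCast, ← hN, Complex.ofReal_div, Complex.ofReal_one, e2, e4, div_pow,
    div_pow, neg_pow, neg_pow (_ ^ 4 - 1), pow_add, ← pow_mul, ← pow_mul]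
  have hs : (-1 : ℂ) ^ p * (-1) ^ q = -1 := by rw [← pow_add, hodd.neg_one_pow]
  have hs' : (-1 : ℂ) ^ p * ((x : ℂ) ^ 2 - 1) ^ p / x ^ (2 * p) *
      ((-1) ^ q * ((x : ℂ) ^ 4 - 1) ^ q / x ^ (4 * q)) =
      -((((x : ℂ) ^ 2 - 1) ^ p * ((x : ℂ) ^ 4 - 1) ^ q) / (x ^ (2 * p) * x ^ (4 * q))) := by
    linear_combination ((x : ℂ) ^ 2 - 1) ^ p * ((x : ℂ) ^ 4 - 1) ^ q /
      (x ^ (2 * p) * x ^ (4 * q)) * hs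
  rw [hs']
  push_cast
  rw [one_div, inv_neg, inv_div, one_div]
  ring

theorem exp_smul_absoluteHurwitzIntegrand {p q N : ℕ} (hN : 2 * p + 4 * q = N) {f : ℝ → ℂ}
    (hf : ∀ x : ℝ, f x = -(1 / (((x : ℂ) ^ 2 - 1) ^ p * ((x : ℂ) ^ 4 - 1) ^ q)))
    (w s : ℂ) (t : ℝ) :
    Real.exp t • absoluteHurwitzIntegrand f w s (Real.exp t) =
      -((t : ℂ) ^ (w - 1) * barnesKernel p q (s + N) t) := by
  have hexp : Complex.exp t ≠ 0 := Complex.exp_ne_zero _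
  have e2 : Complex.exp t ^ 2 - 1 = Complex.exp t ^ 2 * (1 - Complex.exp (-(2 * t))) := by
    rw [mul_sub, mul_one, ← Complex.exp_nat_mul, ← Complex.exp_add]
    push_cast
    simp
  have e4 : Complex.exp t ^ 4 - 1 = Complex.exp t ^ 4 * (1 - Complex.exp (-(4 * t))) := by
    rw [mul_sub, mul_one, ← Complex.exp_nat_mul, ← Complex.exp_add]
    push_cast
    simp
  have e5 : Complex.exp t * Complex.exp t ^ (-s - 1) = Complex.exp (-(s * t)) := by
    rw [Complex.cpow_def_of_ne_zero hexp, ← Complex.ofReal_exp, ← Complex.ofReal_log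
      (Real.exp_pos t).le, Real.log_exp, Complex.ofReal_exp, ← Complex.exp_add]
    congr 1
    ring
  have e6 : Complex.exp (-((s + N) * t)) = Complex.exp (-(s * t)) *
      ((Complex.exp t ^ 2) ^ p * (Complex.exp t ^ 4) ^ q)⁻¹ := by
    rw [← pow_mul, ← pow_mul, ← pow_add, hN, ← Complex.exp_nat_mul, ← Complex.exp_neg,
      ← Complex.exp_add]
    congr 1
    ring
  rw [absoluteHurwitzIntegrand, hf, Real.log_exp, barnesKernel, e6, ← e5, Complex.real_smul,
    Complex.ofReal_exp, e2, e4, mul_pow, mul_pow]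
  simp only [mul_inv, one_div]
  ring

theorem absoluteHurwitzIntegral_eq {p q N : ℕ} (hN : 2 * p + 4 * q = N) {f : ℝ → ℂ}
    (hf : ∀ x : ℝ, f x = -(1 / (((x : ℂ) ^ 2 - 1) ^ p * ((x : ℂ) ^ 4 - 1) ^ q))) (w s : ℂ) :
    absoluteHurwitzIntegral f w s = -((Complex.Gamma w)⁻¹ *
      ∫ t : ℝ in Ioi 0, (t : ℂ) ^ (w - 1) * barnesKernel p q (s + N) t) := by
  rw [absoluteHurwitzIntegral, ← Real.exp_zero, ← integral_comp_exp_Ioi,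
    setIntegral_congr_fun measurableSet_Ioi fun t _ =>
      exp_smul_absoluteHurwitzIntegrand hN hf w s t, integral_neg, mul_neg]

theorem integrableOn_absoluteHurwitzIntegrand {p q N : ℕ} (hN : 2 * p + 4 * q = N) {f : ℝ → ℂ}
    (hf : ∀ x : ℝ, f x = -(1 / (((x : ℂ) ^ 2 - 1) ^ p * ((x : ℂ) ^ 4 - 1) ^ q))) {w s : ℂ}
    (h : IntegrableOn (fun t : ℝ => (t : ℂ) ^ (w - 1) * barnesKernel p q (s + N) t) (Ioi 0)) :
    IntegrableOn (absoluteHurwitzIntegrand f w s) (Ioi 1) := by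
  rw [← Real.exp_zero, ← integrableOn_comp_exp_Ioi]
  exact h.neg.congr_fun (fun t _ => (exp_smul_absoluteHurwitzIntegrand hN hf w s t).symm)
    measurableSet_Ioi

theorem prod_bipartitePeriods {n₁ n₂ p q : ℕ} (hp : ((n₁ : ℤ) - 2) * ((n₂ : ℤ) - 2) = p)
    (hpq : p + q = (n₁ - 1) * (n₂ - 1) + 1) (g : ℝ → ℂ) :
    ∏ j, g (bipartitePeriods n₁ n₂ j) = g 2 ^ p * g 4 ^ q := by
  simp only [bipartitePeriods, hp, Nat.cast_lt]
  rw [Fin.prod_univ_eq_prod_range (fun j => g (if j < p then 2 else 4)), ← hpq,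
    Finset.prod_range_add]
  congr 1
  · rw [Finset.prod_congr rfl (g := fun _ => g 2) fun j hj => by
      rw [if_pos (Finset.mem_range.mp hj)]]
    simp
  · rw [Finset.prod_congr rfl (g := fun _ => g 4) fun j _ => by
      rw [if_neg (by lia)]]
    simp

theorem bipartitePeriods_pos (n₁ n₂ : ℕ) (j : Fin ((n₁ - 1) * (n₂ - 1) + 1)) :
    0 < bipartitePeriods n₁ n₂ j := by
  rw [bipartitePeriods]
  split_ifs <;> norm_num

theorem sum_bipartitePeriods {n₁ n₂ p q : ℕ} (hp : ((n₁ : ℤ) - 2) * ((n₂ : ℤ) - 2) = p)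
    (hpq : p + q = (n₁ - 1) * (n₂ - 1) + 1) :
    ∑ j, (bipartitePeriods n₁ n₂ j : ℂ) = (2 * p + 4 * q : ℕ) := by
  simp only [bipartitePeriods, hp, Nat.cast_lt]
  rw [Fin.sum_univ_eq_sum_range (fun j => (((if j < p then 2 else 4) : ℝ) : ℂ)), ← hpq,
    Finset.sum_range_add]
  rw [Finset.sum_congr rfl (g := fun _ => (2 : ℂ)) fun j hj => by
      rw [if_pos (Finset.mem_range.mp hj)]; norm_num,
    Finset.sum_congr rfl (s₁ := Finset.range q) (g := fun _ => (4 : ℂ)) fun j _ => by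
      rw [if_neg (by lia)]; norm_num]
  simp
  ring

/-- Because `p > 0`, the period of index `0` is `2`, so every even natural number is a lattice sum.
This places the zeros of `1/Γ_b`, known to be of the form `-2m`, in the set excluded from the
functional equation. -/
theorem sum_single_zero_mul_bipartitePeriods {n₁ n₂ p : ℕ}
    (hp : ((n₁ : ℤ) - 2) * ((n₂ : ℤ) - 2) = p) (hp0 : 0 < p) (m : ℕ) :
    ∑ j, ((Pi.single 0 m : Fin ((n₁ - 1) * (n₂ - 1) + 1) → ℕ) j : ℂ) *
      (bipartitePeriods n₁ n₂ j : ℂ) = 2 * m := by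
  rw [Finset.sum_eq_single 0 (fun j _ hj => by simp [hj]) (by simp)]
  simp [bipartitePeriods, hp, hp0, mul_comm]

theorem IsMeromorphicContinuation.neg {F g : ℂ → ℂ} (h : IsMeromorphicContinuation F g) :
    IsMeromorphicContinuation (fun z => -F z) (fun z => -g z) := by
  obtain ⟨hg, c, hc⟩ := h
  refine ⟨fun z hz => ?_, c, fun z hz => congrArg Neg.neg (hc z hz)⟩
  have := (meromorphicNFAt_mul_iff_right (f := g) (g := fun _ => (-1 : ℂ)) (x := z)
    analyticAt_const (by simp)).mpr (hg hz)
  simpa [Pi.mul_def] using this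

theorem ContinuesRegularly.isMeromorphicContinuation {F M : ℂ → ℂ} {c : ℝ}
    (h : ContinuesRegularly F M c) : IsMeromorphicContinuation F (meromorphicContinuation F) :=
  ⟨h.meromorphicNFOn, c, fun _ hw => h.meromorphicContinuation_apply hw⟩

/-- The absolute Hurwitz zeta function in terms of the multiple Hurwitz zeta function. -/
theorem absoluteHurwitzZeta_eq_neg_multipleHurwitzZeta {r : ℕ} {ω : Fin r → ℝ} {f : ℝ → ℂ}
    {s x : ℂ} {M : ℂ → ℂ} {c : ℝ}
    (hM : ContinuesRegularly (fun w => ∑' k, multipleHurwitzTerm w x ω k) M c)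
    (hI : ∀ w : ℂ, c < w.re →
      absoluteHurwitzIntegral f w s = -∑' k, multipleHurwitzTerm w x ω k) :
    (fun w => absoluteHurwitzZeta f w s) = fun w => -multipleHurwitzZeta w x ω := by
  have h := hM.isMeromorphicContinuation.neg
  have h' : IsMeromorphicContinuation (fun w => absoluteHurwitzIntegral f w s)
      (fun w => -multipleHurwitzZeta w x ω) := by
    refine ⟨h.1, c, fun w hw => ?_⟩
    beta_reduce
    rw [hI w hw, multipleHurwitzZeta, hM.meromorphicContinuation_apply hw]
  exact meromorphicContinuation_eq h'

/-- The absolute zeta function of `-(u ^ 2 - 1) ^ (-p) (u ^ 4 - 1) ^ (-q)` and its functional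
equation, in terms of the multiple gamma and sine functions of its periods. -/
theorem absoluteZeta_eq_multipleGamma_inv {d p q N : ℕ} {ω : Fin (d + 1) → ℝ}
    (hN : 2 * p + 4 * q = N) (hpq : p + q = d + 1) (hodd : Odd (d + 1)) (hω : ∀ j, 0 < ω j)
    (hprod : ∀ g : ℝ → ℂ, ∏ j, g (ω j) = g 2 ^ p * g 4 ^ q) (hsum : ∑ j, (ω j : ℂ) = N)
    (hlattice : ∀ m : ℕ, ∃ k : Fin (d + 1) → ℕ, ∑ j, (k j : ℂ) * (ω j : ℂ) = 2 * m) {f : ℝ → ℂ}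
    (hf : ∀ x : ℝ, f x = -(1 / (((x : ℂ) ^ 2 - 1) ^ p * ((x : ℂ) ^ 4 - 1) ^ q))) :
    (∀ s : ℂ, 0 < (s + N).re →
      (∀ w : ℂ, ((d + 1 : ℕ) : ℝ) < w.re →
        IntegrableOn (absoluteHurwitzIntegrand f w s) (Ioi 1) ∧
        absoluteHurwitzZeta f w s = absoluteHurwitzIntegral f w s ∧
        HasSum (multipleHurwitzTerm w (s + N) ω) (-absoluteHurwitzZeta f w s)) ∧
      MeromorphicNFOn (fun w => absoluteHurwitzZeta f w s) univ ∧
      AnalyticAt ℂ (fun w => absoluteHurwitzZeta f w s) 0 ∧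
      (∀ w : ℂ, absoluteHurwitzZeta f w s = -multipleHurwitzZeta w (s + N) ω) ∧
      absoluteZeta f s = Complex.exp (deriv (fun w => absoluteHurwitzZeta f w s) 0)) ∧
    MeromorphicNFOn (absoluteZeta f) univ ∧
    (∀ s : ℂ, absoluteZeta f s = (multipleGamma (s + N) ω)⁻¹) ∧
    (∀ s : ℂ, (∀ k : Fin (d + 1) → ℕ, s ≠ ∑ j, (k j : ℂ) * (ω j : ℂ) ∧
        s + N ≠ -∑ j, (k j : ℂ) * (ω j : ℂ)) →
      (absoluteZeta f (-N - s))⁻¹ = (multipleSine (s + N) ω)⁻¹ * absoluteZeta f s) := by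
  obtain ⟨G, hGd, hG0, hG⟩ := exists_entire_multipleGamma_inv hpq hω hprod
  have hcast : ((d + 1 : ℕ) : ℝ) = (d + 1 : ℝ) := by push_cast; rfl
  have hI (s : ℂ) (hs : 0 < (s + N).re) (w : ℂ) (hw : (d + 1 : ℝ) < w.re) :
      absoluteHurwitzIntegral f w s = -∑' k, multipleHurwitzTerm w (s + N) ω k := by
    rw [absoluteHurwitzIntegral_eq hN hf, (((hG _ hs).1 w hw).2).tsum_eq]
  have hZ (s : ℂ) (hs : 0 < (s + N).re) :
      (fun w => absoluteHurwitzZeta f w s) = fun w => -multipleHurwitzZeta w (s + N) ω := by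
    obtain ⟨M, hM, -⟩ := (hG _ hs).2
    exact absoluteHurwitzZeta_eq_neg_multipleHurwitzZeta hM (hI s hs)
  have hderiv (x : ℂ) (hx : 0 < x.re) :
      Complex.exp (-deriv (fun w => multipleHurwitzZeta w x ω) 0) = G x := by
    obtain ⟨M, hM, hMG⟩ := (hG _ hx).2
    rw [← hMG, ← hM.meromorphicContinuation_eventuallyEq.deriv_eq]
    rfl
  -- The inverse of an entire function is already in normal form, with value `0` at its poles, so it
  -- is the continuation at every point.
  have hgamma : (fun x => multipleGamma x ω) = G⁻¹ := by
    refine meromorphicContinuation_eq ⟨?_, 0, fun x hx => ?_⟩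
    · exact meromorphicNFOn_inv.mpr (AnalyticOnNhd.meromorphicNFOn fun z _ => hGd.analyticAt z)
    · rw [Pi.inv_apply, ← hderiv x hx, ← Complex.exp_neg, neg_neg]
  have hGs : Differentiable ℂ fun s => G (s + N) := hGd.comp (by fun_prop)
  have hGNF : MeromorphicNFOn (fun s => G (s + N)) univ :=
    AnalyticOnNhd.meromorphicNFOn fun z _ => hGs.analyticAt z
  have hre (s : ℂ) : (s + N).re = s.re + N := by simp
  have hexp (s : ℂ) (hs : 0 < (s + N).re) :
      G (s + N) = Complex.exp (deriv (fun w => absoluteHurwitzZeta f w s) 0) := by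
    rw [hZ s hs, ← hderiv _ hs, deriv.fun_neg]
  have hzeta : absoluteZeta f = fun s => G (s + N) := by
    refine meromorphicContinuation_eq ⟨hGNF, -N, fun s hs => hexp s ?_⟩
    rw [hre]
    linarith
  have hzg (s : ℂ) : absoluteZeta f s = (multipleGamma (s + N) ω)⁻¹ := by
    rw [hzeta, congrFun hgamma (s + N), Pi.inv_apply, inv_inv]
  refine ⟨fun s hs => ?_, hzeta ▸ hGNF, hzg, fun s hs => ?_⟩
  · obtain ⟨hHS, M, hM, -⟩ := hG _ hs
    have hZs := hZ s hs
    have hval (w : ℂ) (hw : (d + 1 : ℝ) < w.re) :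
        absoluteHurwitzZeta f w s = absoluteHurwitzIntegral f w s := by
      rw [congrFun hZs w, hI s hs w hw, multipleHurwitzZeta, hM.meromorphicContinuation_apply hw]
    refine ⟨fun w hw => ?_, ?_, ?_, congrFun hZs, ?_⟩
    · rw [hcast] at hw
      refine ⟨integrableOn_absoluteHurwitzIntegrand hN hf (hHS w hw).1, hval w hw, ?_⟩
      rw [hval w hw, absoluteHurwitzIntegral_eq hN hf, neg_neg]
      exact (hHS w hw).2
    · rw [hZs]
      exact hM.isMeromorphicContinuation.neg.1
    · rw [hZs]
      exact (hM.analyticAt_zero.congr hM.meromorphicContinuation_eventuallyEq.symm).fun_neg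
    · rw [hzeta]
      exact hexp s hs
  · have hne : G (s + N) ≠ 0 := fun h => by
      obtain ⟨m, hm⟩ := hG0 _ h
      obtain ⟨k, hk⟩ := hlattice m
      exact (hs k).2 (by rw [hm, hk])
    -- Since `d + 1` is odd, the second gamma factor of the sine is inverted, and the sine equals `G
    -- (s + N) * G (-s)`. The nonvanishing of `G (s + N)` permits the cancellation.
    rw [hzeta, multipleSine, hsum, hodd.neg_one_pow, zpow_neg_one, congrFun hgamma (s + N),
      congrFun hgamma (N - (s + N)), Pi.inv_apply, Pi.inv_apply]
    simp only [show -(N : ℂ) - s + N = N - (s + N) by ring, inv_inv, mul_inv]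
    field_simp

end GroverAbsoluteZeta

theorem proposition6 (n₁ n₂ : ℕ) (hn : (n₁ = 1 ∧ n₂ = 1) ∨ (n₁ = 3 ∧ 3 ≤ n₂)) :
    let ζU : ℂ → ℂ := groverZeta (completeBipartiteGraph (Fin n₁) (Fin n₂))
    let f : ℝ → ℂ := fun x => ζU (x : ℂ)
    let b : ℕ := (n₁ - 1) * (n₂ - 1) + 1
    let N : ℂ := 2 * (n₁ : ℂ) * (n₂ : ℂ)
    let ω : Fin b → ℝ := bipartitePeriods n₁ n₂
    -- the zeta function of the Grover walk, and its automorphy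
    (∀ u : ℂ, ζU u =
      -(1 / ((u ^ 2 - 1) ^ (((n₁ : ℤ) - 2) * ((n₂ : ℤ) - 2)) * (u ^ 4 - 1) ^ (n₁ + n₂ - 2)))) ∧
    IsAbsoluteAutomorphicForm f (-1) (-(2 * (n₁ : ℤ) * (n₂ : ℤ))) ∧
    -- the absolute Hurwitz zeta function, on the half-plane where its integral can converge
    (∀ s : ℂ, 0 < (s + N).re →
      (∀ w : ℂ, (b : ℝ) < w.re →
        MeasureTheory.IntegrableOn (absoluteHurwitzIntegrand f w s) (Set.Ioi 1) ∧
        absoluteHurwitzZeta f w s = absoluteHurwitzIntegral f w s ∧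
        HasSum (multipleHurwitzTerm w (s + N) ω) (-absoluteHurwitzZeta f w s)) ∧
      MeromorphicNFOn (fun w => absoluteHurwitzZeta f w s) Set.univ ∧
      AnalyticAt ℂ (fun w => absoluteHurwitzZeta f w s) 0 ∧
      (∀ w : ℂ, absoluteHurwitzZeta f w s = -multipleHurwitzZeta w (s + N) ω) ∧
      absoluteZeta f s = Complex.exp (deriv (fun w => absoluteHurwitzZeta f w s) 0)) ∧
    -- the absolute zeta function, on the whole plane
    MeromorphicNFOn (absoluteZeta f) Set.univ ∧
    (∀ s : ℂ, absoluteZeta f s = (multipleGamma (s + N) ω)⁻¹) ∧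
    -- the functional equation, away from the poles of its factors
    (∀ s : ℂ, (∀ k : Fin b → ℕ, s ≠ ∑ j, (k j : ℂ) * (ω j : ℂ) ∧
        s + N ≠ -∑ j, (k j : ℂ) * (ω j : ℂ)) →
      (absoluteZeta f (-N - s))⁻¹ = (multipleSine (s + N) ω)⁻¹ * absoluteZeta f s) := by
  intro ζU f b N ω
  obtain ⟨p, q, h₁, h₂, hp, hp0, hpq, hq, hodd, hN⟩ : ∃ p q : ℕ, n₁ ≠ 0 ∧ n₂ ≠ 0 ∧
      ((n₁ : ℤ) - 2) * ((n₂ : ℤ) - 2) = p ∧ 0 < p ∧ p + q = (n₁ - 1) * (n₂ - 1) + 1 ∧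
      n₁ - 1 + (n₂ - 1) = q ∧ Odd (p + q) ∧ 2 * p + 4 * q = 2 * n₁ * n₂ := by
    rcases hn with ⟨rfl, rfl⟩ | ⟨rfl, h3⟩
    · exact ⟨1, 0, by norm_num, by norm_num, by norm_num, by norm_num, by norm_num, by norm_num,
        by norm_num, by norm_num⟩
    · obtain ⟨m, rfl⟩ := Nat.exists_eq_add_of_le h3
      -- With `n₂ = m + 3`, `p = n₂ - 2` and `q = n₂ + 1`, so `p + q = 2(m + 2) + 1` is odd.
      refine ⟨m + 1, m + 4, by lia, by lia, by push_cast; ring, by lia, by lia, by lia,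
        ⟨m + 2, by ring⟩, by ring⟩
  have hζ (u : ℂ) : ζU u = -(1 / ((u ^ 2 - 1) ^ p * (u ^ 4 - 1) ^ q)) :=
    groverZeta_eq_neg_one_div h₁ h₂ hpq hq hodd u
  have hNc : N = ((2 * n₁ * n₂ : ℕ) : ℂ) := by simp [N]
  have hsum : ∑ j, (ω j : ℂ) = ((2 * n₁ * n₂ : ℕ) : ℂ) := by
    rw [← hN]
    exact sum_bipartitePeriods hp hpq
  refine ⟨fun u => ?_, ?_, ?_⟩
  · rw [hζ, hp, zpow_natCast, show n₁ + n₂ - 2 = q by lia]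
  · have := isAbsoluteAutomorphicForm_neg_one_div (f := f) hN hodd fun x => hζ x
    simpa using this
  · rw [hNc]
    exact absoluteZeta_eq_multipleGamma_inv hN hpq (hpq ▸ hodd) (bipartitePeriods_pos n₁ n₂)
      (prod_bipartitePeriods hp hpq) hsum
      (fun m => ⟨_, sum_single_zero_mul_bipartitePeriods hp hp0 m⟩) fun x => hζ x
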